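/- Work over $\mathbb{C}$ and let $n\ge 1$. A rational normal curve in $\mathbb{P}^n$ is the image of an embedding $\mathbb{P}^1\to\mathbb{P}^n$, $[s:t]\mapsto[f_0(s,t):\dots:f_n(s,t)]$, where $f_0,\dots,f_n$ is a basis of the space of binary forms of degree $n$. A codimension-two linear space $\Lambda\subset\mathbb{P}^n$ (empty if $n=1$) is called $(n-1)$-secant to such a curve $\mathcal{C}$ if $\Lambda\cap\mathcal{C}$ consists of exactly $n-1$ distinct points. Then for two points and $n+1$ codimension-two linear spaces of $\mathbb{P}^n$ in generic position there exists a unique rational normal curve in $\mathbb{P}^n$ passing through the two points and $(n-1)$-secant to all $n+1$ linear spaces. Here "in generic position" means: there is a proper Zariski closed subset $Z$ of $G(n-2,\mathbb{P}^n)^{n+1}\times(\mathbb{P}^n)^2$ such that the assertion holds for all $(\Lambda_1,\dots,\Lambda_{n+1},P_1,P_2)\notin Z$. -/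

import Mathlib

open scoped LinearAlgebra.Projectivization

namespace RNC

/-- Complex projective space `ℙⁿ`: lines through the origin of `ℂⁿ⁺¹`. -/
abbrev PSpace (n : ℕ) : Type := ℙ ℂ (Fin (n + 1) → ℂ)

/-- Codimension two linear spaces in `ℙⁿ`, i.e. the points of the Grassmannian `G(n-2, ℙⁿ)`,
given as the linear subspaces of codimension two of `ℂⁿ⁺¹`. -/
abbrev CodimTwoSpace (n : ℕ) : Type :=
  { L : Submodule ℂ (Fin (n + 1) → ℂ) // Module.finrank ℂ ((Fin (n + 1) → ℂ) ⧸ L) = 2 }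

/-- The set of points of `ℙⁿ` that lie on the projective linear space defined by `L`. -/
def pointSet {n : ℕ} (L : Submodule ℂ (Fin (n + 1) → ℂ)) : Set (PSpace n) :=
  { x | x.submodule ≤ L }

/-- A rational normal curve in `ℙⁿ`: the image of the embedding of `ℙ¹` by the complete linear
system of binary forms of degree `n`, that is, the image of `[s₀ : s₁] ↦ [f₀(s) : … : fₙ(s)]`
where `f₀, …, fₙ` is a basis of the `(n+1)`-dimensional space of binary forms of degree `n`. -/
def IsRationalNormalCurve {n : ℕ} (C : Set (PSpace n)) : Prop :=
  ∃ f : Fin (n + 1) → MvPolynomial (Fin 2) ℂ,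
    (∀ i, (f i).IsHomogeneous n) ∧ LinearIndependent ℂ f ∧
      C = { x | ∃ s : Fin 2 → ℂ, s ≠ 0 ∧
        ∃ h : (fun i => MvPolynomial.eval s (f i)) ≠ 0,
          x = Projectivization.mk ℂ (fun i => MvPolynomial.eval s (f i)) h }

/-- A linear space is `k`-secant to `C` if it meets `C` in exactly `k` distinct points. -/
def IsSecant {n : ℕ} (k : ℕ) (C : Set (PSpace n)) (L : Submodule ℂ (Fin (n + 1) → ℂ)) : Prop :=
  (pointSet L ∩ C).encard = k

/-- The data space `G(n-2, ℙⁿ)ˡ × (ℙⁿ)ᵖ`. -/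
structure Datum (n l p : ℕ) where
  spaces : Fin l → CodimTwoSpace n
  points : Fin p → PSpace n

/-- Index set of the coordinates of a datum: the coefficients of two linear equations for each
linear space, and the homogeneous coordinates of each point. -/
abbrev CoordIndex (n l p : ℕ) : Type :=
  (Fin l × Fin 2 × Fin (n + 1)) ⊕ (Fin p × Fin (n + 1))

/-- `c` is a choice of coordinates of `δ`: each linear space is the zero set of the two linear
forms with the given coefficients, and each point is spanned by the given (nonzero) vector. -/
def Datum.HasCoords {n l p : ℕ} (δ : Datum n l p) (c : CoordIndex n l p → ℂ) : Prop :=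
  (∀ i, ∀ x : Fin (n + 1) → ℂ,
    x ∈ (δ.spaces i).1 ↔ ∀ k, ∑ m, c (Sum.inl (i, k, m)) * x m = 0) ∧
  (∀ j, (δ.points j).submodule = Submodule.span ℂ {fun m => c (Sum.inr (j, m))})

/-- Zariski closed subsets of the data space: those that are cut out by polynomial equations in
the coordinates. (This is the quotient topology from the space of coordinates, which is the usual
Zariski topology on a product of Grassmannians and projective spaces.) -/
def IsZariskiClosed {n l p : ℕ} (Z : Set (Datum n l p)) : Prop :=
  ∃ S : Set (MvPolynomial (CoordIndex n l p) ℂ),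
    ∀ (δ : Datum n l p) (c : CoordIndex n l p → ℂ), δ.HasCoords c →
      (δ ∈ Z ↔ ∀ f ∈ S, MvPolynomial.eval c f = 0)

/-- A property holds for the generic datum if it holds outside a proper Zariski closed subset of
the (irreducible) data space. -/
def HoldsForGeneric {n l p : ℕ} (P : Datum n l p → Prop) : Prop :=
  ∃ Z : Set (Datum n l p), IsZariskiClosed Z ∧ Z ≠ Set.univ ∧ ∀ δ, δ ∉ Z → P δ

end RNC

/-! ### Coordinates of a datum and open conditions on them. -/

namespace RNC

open MvPolynomial

/-! The hyperplanes through Λ_i form a pencil. A rational normal curve that is (n-1)-secant to Λ_i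
has one free intersection point with each of them, so every one of the n+1 pencils parametrises the
curve. Let A_i and B_i be the members through P_1 and P_2. If the parameters 0 and ∞ go to P_1 and
P_2, then e_i A_i = t B_i at the point with parameter t, for constants e_i ≠ 0.

Uniqueness: all A_i vanish at P_1, so in general they satisfy a single linear relation, with
coefficients α_i; likewise the B_i, with coefficients β_i. The curve spans the space, so e_i A_i = t
B_i gives ∑ β_i e_i A_i = 0, hence β_i e_i = κ α_i. Up to rescaling t, the curve is therefore the
locus α_i A_i = t β_i B_i, which depends on the datum only (`exists_pencil_parameters`,
`eq_curve_of_isSecant`).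

Existence: the rows of the balanced matrix pencil α_i A_i - t β_i B_i sum to zero, so it is singular
for every t, and a column of its adjugate, of degree at most n in t, spans its kernel. This column
parametrises the curve (`curveMatrix`, `exists_eq_smul_curve`). Along it A_i is a polynomial of
degree n in t; the root 0 is P_1, and the other n-1 roots are the points on Λ_i (`isSecant_curve`).

All that is required of the datum is the nonvanishing of one polynomial, `genericity`. It is nonzero
for suitable spaces secant to the standard curve (`genericity_ne_zero`), and
`holdsForGeneric_of_eval_ne_zero` turns this into a proper closed subset. -/

/-- The linear map `ℂⁿ⁺¹ → ℂ²` given by the two equations of the `i`-th linear space. -/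
noncomputable def equationMap {n l p : ℕ} (c : CoordIndex n l p → ℂ) (i : Fin l) :
    (Fin (n + 1) → ℂ) →ₗ[ℂ] (Fin 2 → ℂ) :=
  Matrix.toLin' (Matrix.of fun k m => c (Sum.inl (i, k, m)))

theorem equationMap_apply {n l p : ℕ} (c : CoordIndex n l p → ℂ) (i : Fin l)
    (x : Fin (n + 1) → ℂ) (k : Fin 2) :
    equationMap c i x k = ∑ m, c (Sum.inl (i, k, m)) * x m := by
  simp [equationMap, Matrix.mulVec, dotProduct]

theorem Datum.HasCoords.mem_iff {n l p : ℕ} {δ : Datum n l p} {c : CoordIndex n l p → ℂ}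
    (h : δ.HasCoords c) (i : Fin l) (x : Fin (n + 1) → ℂ) :
    x ∈ (δ.spaces i).1 ↔ equationMap c i x = 0 := by
  rw [h.1 i x, funext_iff]
  simp [equationMap_apply]

theorem Datum.HasCoords.surjective {n l p : ℕ} {δ : Datum n l p} {c : CoordIndex n l p → ℂ}
    (h : δ.HasCoords c) (i : Fin l) : Function.Surjective (equationMap c i) := by
  have hk : LinearMap.ker (equationMap c i) = (δ.spaces i).1 := by
    ext x
    rw [LinearMap.mem_ker, h.mem_iff]
  have h2 := (δ.spaces i).2
  rw [← hk, (equationMap c i).quotKerEquivRange.finrank_eq] at h2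
  rw [← LinearMap.range_eq_top]
  exact Submodule.eq_top_of_finrank_eq (by simpa using h2)

/-- The change of coordinates that replaces the equations of each linear space by invertible linear
combinations and rescales the vectors that span the points. -/
def changeCoords {n l p : ℕ} {R : Type*} [CommRing R] (T : Fin l → Matrix (Fin 2) (Fin 2) R)
    (μ : Fin p → R) (c : CoordIndex n l p → R) : CoordIndex n l p → R :=
  Sum.elim (fun a => ∑ k, T a.1 a.2.1 k * c (Sum.inl (a.1, k, a.2.2)))
    (fun b => μ b.1 * c (Sum.inr b))

theorem equationMap_changeCoords {n l p : ℕ} (T : Fin l → Matrix (Fin 2) (Fin 2) ℂ)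
    (μ : Fin p → ℂ) (c : CoordIndex n l p → ℂ) (i : Fin l) (x : Fin (n + 1) → ℂ) :
    equationMap (changeCoords T μ c) i x = (T i).mulVec (equationMap c i x) := by
  ext k
  simp only [equationMap_apply, changeCoords, Sum.elim_inl, Matrix.mulVec, dotProduct,
    Fin.sum_univ_two, Finset.mul_sum, ← Finset.sum_add_distrib]
  exact Finset.sum_congr rfl fun m _ => by ring

theorem Datum.HasCoords.changeCoords {n l p : ℕ} {δ : Datum n l p} {c : CoordIndex n l p → ℂ}
    (h : δ.HasCoords c) {T : Fin l → Matrix (Fin 2) (Fin 2) ℂ} {μ : Fin p → ℂ}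
    (hT : ∀ i, (T i).det ≠ 0) (hμ : ∀ j, μ j ≠ 0) : δ.HasCoords (changeCoords T μ c) := by
  constructor
  · intro i x
    have : (∀ k, ∑ m, RNC.changeCoords T μ c (Sum.inl (i, k, m)) * x m = 0) ↔
        equationMap (RNC.changeCoords T μ c) i x = 0 := by
      rw [funext_iff]
      simp [equationMap_apply]
    rw [this, h.mem_iff, equationMap_changeCoords]
    exact ⟨fun h0 => by rw [h0, Matrix.mulVec_zero], Matrix.eq_zero_of_mulVec_eq_zero (hT i)⟩
  · intro j
    rw [h.2 j]
    have : (fun m => RNC.changeCoords T μ c (Sum.inr (j, m))) =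
        μ j • fun m => c (Sum.inr (j, m)) := by
      ext m
      simp [RNC.changeCoords]
    rw [this, Submodule.span_singleton_smul_eq (IsUnit.mk0 _ (hμ j))]

/-- Two surjections onto `ℂ²` with the same kernel differ by an automorphism of `ℂ²`, and two
generators of a line by a scalar. This makes conditions on coordinates into conditions on the datum.
-/
theorem Datum.HasCoords.exists_changeCoords {n l p : ℕ} {δ : Datum n l p}
    {c c' : CoordIndex n l p → ℂ} (h : δ.HasCoords c) (h' : δ.HasCoords c') :
    ∃ (T : Fin l → Matrix (Fin 2) (Fin 2) ℂ) (μ : Fin p → ℂ),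
      (∀ i, (T i).det ≠ 0) ∧ (∀ j, μ j ≠ 0) ∧ c' = RNC.changeCoords T μ c := by
  have hT : ∀ i, ∃ T : Matrix (Fin 2) (Fin 2) ℂ, T.det ≠ 0 ∧
      ∀ x, equationMap c' i x = T.mulVec (equationMap c i x) := by
    intro i
    obtain ⟨g, hg⟩ := (equationMap c i).exists_rightInverse_of_surjective
      (LinearMap.range_eq_top.2 (h.surjective i))
    -- `x` and `g (equationMap c i x)` differ by an element of the common kernel.
    have hcomp : ∀ x, equationMap c' i (g (equationMap c i x)) = equationMap c' i x := by
      intro x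
      rw [← sub_eq_zero, ← map_sub, ← h'.mem_iff, h.mem_iff, map_sub, sub_eq_zero]
      exact LinearMap.congr_fun hg (equationMap c i x)
    refine ⟨LinearMap.toMatrix' (equationMap c' i ∘ₗ g), ?_, fun x => ?_⟩
    · have hs : Function.Surjective (equationMap c' i ∘ₗ g) := by
        intro y
        obtain ⟨x, rfl⟩ := h'.surjective i y
        exact ⟨equationMap c i x, hcomp x⟩
      have hu : IsUnit (equationMap c' i ∘ₗ g) :=
        (LinearMap.isUnit_iff_range_eq_top _).2 (LinearMap.range_eq_top.2 hs)
      rw [LinearMap.det_toMatrix']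
      exact (LinearMap.isUnit_det _ hu).ne_zero
    · rw [LinearMap.toMatrix'_mulVec]
      exact (hcomp x).symm
  have hμ : ∀ j, ∃ a : ℂ, a ≠ 0 ∧ ∀ m, c' (Sum.inr (j, m)) = a * c (Sum.inr (j, m)) := by
    intro j
    have h1 := h.2 j
    rw [h'.2 j, Submodule.span_singleton_eq_span_singleton] at h1
    obtain ⟨z, hz⟩ := h1
    refine ⟨(z⁻¹ : ℂˣ), Units.ne_zero _, fun m => ?_⟩
    have := congrFun hz m
    rw [← this]
    simp [Units.smul_def]
  choose T hT hT' using hT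
  choose μ hμ hμ' using hμ
  refine ⟨T, μ, hT, hμ, ?_⟩
  ext a
  rcases a with ⟨i, k, m⟩ | ⟨j, m⟩
  · have := congrFun (hT' i (Pi.single m 1)) k
    simpa [equationMap_apply, Matrix.mulVec, dotProduct, Pi.single_apply, RNC.changeCoords] using this
  · exact hμ' j m

/-- A polynomial condition on the coordinates that is satisfied by some coordinates of some datum
and that implies `P` shows that `P` holds for the generic datum. -/
theorem holdsForGeneric_of_eval_ne_zero {n l p : ℕ} {P : Datum n l p → Prop}
    (F : MvPolynomial (CoordIndex n l p) ℂ)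
    (hF : ∃ (δ : Datum n l p) (c : CoordIndex n l p → ℂ), δ.HasCoords c ∧ eval c F ≠ 0)
    (hP : ∀ (δ : Datum n l p) (c : CoordIndex n l p → ℂ), δ.HasCoords c → eval c F ≠ 0 → P δ) :
    HoldsForGeneric P := by
  refine ⟨{δ | ∀ c, δ.HasCoords c → eval c F = 0}, ?_, ?_, ?_⟩
  -- The equations must detect, from a single `c`, the vanishing of `F` at all coordinates of the
  -- datum; so they are the pullbacks of `F` under all changes of coordinates.
  · refine ⟨{f | ∃ (T : Fin l → Matrix (Fin 2) (Fin 2) ℂ) (μ : Fin p → ℂ),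
      (∀ i, (T i).det ≠ 0) ∧ (∀ j, μ j ≠ 0) ∧
        f = bind₁ (changeCoords (fun i => (T i).map C) (fun j => C (μ j)) X) F}, ?_⟩
    have key : ∀ (T : Fin l → Matrix (Fin 2) (Fin 2) ℂ) (μ : Fin p → ℂ)
        (c : CoordIndex n l p → ℂ),
        eval c (bind₁ (changeCoords (fun i => (T i).map C) (fun j => C (μ j)) X) F) =
          eval (changeCoords T μ c) F := by
      intro T μ c
      have : (fun a => eval c (changeCoords (fun i => (T i).map C) (fun j => C (μ j)) X a)) =
          changeCoords T μ c := by
        ext a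
        rcases a with ⟨i, k, m⟩ | ⟨j, m⟩ <;> simp [changeCoords]
      rw [← this, ← coe_aeval_eq_eval, RingHom.coe_coe, aeval_bind₁]
      rfl
    intro δ c h
    constructor
    · rintro hδ f ⟨T, μ, hT, hμ, rfl⟩
      rw [key]
      exact hδ _ (h.changeCoords hT hμ)
    · intro hS c' h'
      obtain ⟨T, μ, hT, hμ, rfl⟩ := h.exists_changeCoords h'
      rw [← key]
      exact hS _ ⟨T, μ, hT, hμ, rfl⟩
  · obtain ⟨δ, c, h, hne⟩ := hF
    intro hZ
    have : δ ∈ {δ : Datum n l p | ∀ c, δ.HasCoords c → eval c F = 0} := hZ ▸ Set.mem_univ _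
    exact hne (this c h)
  · intro δ hδ
    simp only [Set.mem_ofPred_eq, not_forall] at hδ
    obtain ⟨c, h, hne⟩ := hδ
    exact hP δ c h hne

end RNC

/-! ### Rational normal curves as invertible matrices applied to the Veronese map. -/

namespace RNC

open MvPolynomial

/-- The values at `s` of the monomials of degree `n`. -/
def veronese (n : ℕ) (s : Fin 2 → ℂ) : Fin (n + 1) → ℂ := fun k => s 0 ^ (k : ℕ) * s 1 ^ (n - k)

theorem veronese_ne_zero {n : ℕ} {s : Fin 2 → ℂ} (hs : s ≠ 0) : veronese n s ≠ 0 := by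
  intro h
  have h0 := congrFun h 0
  have h1 := congrFun h (Fin.last n)
  simp only [veronese, Fin.val_zero, pow_zero, one_mul, Nat.sub_zero, Pi.zero_apply,
    Fin.val_last, Nat.sub_self, mul_one] at h0 h1
  refine hs (funext fun i => ?_)
  fin_cases i
  · by_contra h; exact pow_ne_zero _ h h1
  · by_contra h; exact pow_ne_zero _ h h0

theorem veronese_smul {n : ℕ} (a : ℂ) (s : Fin 2 → ℂ) :
    veronese n (a • s) = a ^ n • veronese n s := by
  ext k
  have : a ^ n = a ^ (k : ℕ) * a ^ (n - k) := by
    rw [← pow_add, Nat.add_sub_cancel' k.is_le]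
  simp only [veronese, Pi.smul_apply, smul_eq_mul, this]
  ring

/-- The exponent of the `k`-th monomial of degree `n`. -/
noncomputable def binaryExponent (n : ℕ) (k : Fin (n + 1)) : Fin 2 →₀ ℕ :=
  Finsupp.single 0 (k : ℕ) + Finsupp.single 1 (n - k)

theorem binaryExponent_apply_zero (n : ℕ) (k : Fin (n + 1)) : binaryExponent n k 0 = k := by
  simp [binaryExponent]

theorem binaryExponent_apply_one (n : ℕ) (k : Fin (n + 1)) : binaryExponent n k 1 = n - k := by
  simp [binaryExponent]

theorem binaryExponent_injective (n : ℕ) : Function.Injective (binaryExponent n) := by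
  intro j k h
  have := DFunLike.congr_fun h 0
  rw [binaryExponent_apply_zero, binaryExponent_apply_zero] at this
  exact Fin.ext this

/-- The binary form of degree `n` with the given coefficients. -/
noncomputable def binaryForm {n : ℕ} (u : Fin (n + 1) → ℂ) : MvPolynomial (Fin 2) ℂ :=
  ∑ k, monomial (binaryExponent n k) (u k)

theorem coeff_binaryForm {n : ℕ} (u : Fin (n + 1) → ℂ) (k : Fin (n + 1)) :
    coeff (binaryExponent n k) (binaryForm u) = u k := by
  simp [binaryForm, coeff_sum, coeff_monomial, (binaryExponent_injective n).eq_iff]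

theorem isHomogeneous_binaryForm {n : ℕ} (u : Fin (n + 1) → ℂ) :
    (binaryForm u).IsHomogeneous n := by
  refine IsHomogeneous.sum _ _ _ fun k _ => isHomogeneous_monomial _ ?_
  have := k.is_le
  simp [Finsupp.degree_eq_sum, Fin.sum_univ_two, binaryExponent_apply_zero,
    binaryExponent_apply_one]
  omega

theorem eval_binaryForm {n : ℕ} (u : Fin (n + 1) → ℂ) (s : Fin 2 → ℂ) :
    eval s (binaryForm u) = u ⬝ᵥ veronese n s := by
  simp [binaryForm, eval_monomial, dotProduct, veronese, Finsupp.prod_fintype,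
    Fin.prod_univ_two, binaryExponent_apply_zero, binaryExponent_apply_one]

theorem eq_binaryForm_of_isHomogeneous {n : ℕ} {f : MvPolynomial (Fin 2) ℂ} (hf : f.IsHomogeneous n) :
    f = binaryForm fun k : Fin (n + 1) => coeff (binaryExponent n k) f := by
  ext d
  by_cases hd : d.degree = n
  · have h2 : d 0 + d 1 = n := by
      rw [← hd, Finsupp.degree_eq_sum, Fin.sum_univ_two]
    have hd' : d = binaryExponent n ⟨d 0, by omega⟩ := by
      ext i
      fin_cases i
      · simp [binaryExponent_apply_zero]
      · simp [binaryExponent_apply_one]; omega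
    rw [hd', coeff_binaryForm]
  · rw [hf.coeff_eq_zero hd, (isHomogeneous_binaryForm _).coeff_eq_zero hd]

/-- The curve parametrised by the columns of `F` as coefficients of the monomials. -/
def veroneseCurve {n : ℕ} (F : Matrix (Fin (n + 1)) (Fin (n + 1)) ℂ) : Set (PSpace n) :=
  { x | ∃ s : Fin 2 → ℂ, s ≠ 0 ∧ ∃ h : F.mulVec (veronese n s) ≠ 0,
    x = Projectivization.mk ℂ (F.mulVec (veronese n s)) h }

/-- A form is determined by its coefficients, so linear relations among the forms are the vectors in
the left kernel of `F`. -/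
theorem linearIndependent_binaryForm_iff {n : ℕ} {F : Matrix (Fin (n + 1)) (Fin (n + 1)) ℂ} :
    LinearIndependent ℂ (fun m => binaryForm (F m)) ↔ F.det ≠ 0 := by
  have hz : ∀ u : Fin (n + 1) → ℂ, ∑ m, u m • binaryForm (F m) = 0 ↔ Matrix.vecMul u F = 0 := by
    intro u
    have : ∑ m, u m • binaryForm (F m) = binaryForm (Matrix.vecMul u F) := by
      simp only [binaryForm, Finset.smul_sum, smul_monomial, Matrix.vecMul, dotProduct, smul_eq_mul]
      rw [Finset.sum_comm]
      simp [map_sum]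
    rw [this]
    constructor
    · intro h
      ext k
      rw [← coeff_binaryForm (Matrix.vecMul u F) k, h]
      simp
    · intro h
      simp [h, binaryForm]
  rw [Fintype.linearIndependent_iff, Ne, ← Matrix.exists_vecMul_eq_zero_iff]
  simp only [hz]
  constructor
  · rintro h ⟨u, hu, hu'⟩
    exact hu (funext (h u hu'))
  · intro h u hu i
    by_contra hi
    exact h ⟨u, fun h0 => hi (congrFun h0 i), hu⟩

theorem isRationalNormalCurve_veroneseCurve {n : ℕ} {F : Matrix (Fin (n + 1)) (Fin (n + 1)) ℂ}
    (hF : F.det ≠ 0) : IsRationalNormalCurve (veroneseCurve F) := by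
  refine ⟨fun m => binaryForm (F m), fun m => isHomogeneous_binaryForm _,
    linearIndependent_binaryForm_iff.2 hF, ?_⟩
  simp only [eval_binaryForm]
  rfl

theorem exists_veroneseCurve {n : ℕ} {f : Fin (n + 1) → MvPolynomial (Fin 2) ℂ}
    (hf : ∀ i, (f i).IsHomogeneous n) (hi : LinearIndependent ℂ f) :
    ∃ F : Matrix (Fin (n + 1)) (Fin (n + 1)) ℂ, F.det ≠ 0 ∧
      ∀ s, (fun i => eval s (f i)) = F.mulVec (veronese n s) := by
  have h : f = fun m => binaryForm fun k : Fin (n + 1) => coeff (binaryExponent n k) (f m) :=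
    funext fun m => eq_binaryForm_of_isHomogeneous (hf m)
  refine ⟨Matrix.of fun m k => coeff (binaryExponent n k) (f m), ?_, fun s => funext fun m => ?_⟩
  · rw [← linearIndependent_binaryForm_iff]
    rw [h] at hi
    exact hi
  · conv_lhs => rw [h]
    rw [eval_binaryForm]
    rfl

/-- Linear substitution in binary forms. -/
noncomputable def linearSubst (G : Matrix (Fin 2) (Fin 2) ℂ) :
    MvPolynomial (Fin 2) ℂ →ₐ[ℂ] MvPolynomial (Fin 2) ℂ :=
  aeval fun i => ∑ j, C (G i j) * X j

theorem eval_linearSubst (G : Matrix (Fin 2) (Fin 2) ℂ) (s : Fin 2 → ℂ)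
    (f : MvPolynomial (Fin 2) ℂ) : eval s (linearSubst G f) = eval (G.mulVec s) f := by
  have : (eval s).comp (linearSubst G).toRingHom = eval (G.mulVec s) := by
    ext i
    · simp [linearSubst]
    · simp only [linearSubst, AlgHom.toRingHom_eq_coe, RingHom.coe_comp, RingHom.coe_coe,
        Function.comp_apply, aeval_X, map_sum, map_mul, eval_C, eval_X]
      rfl
  exact RingHom.congr_fun this f

theorem isHomogeneous_linearSubst {n : ℕ} {f : MvPolynomial (Fin 2) ℂ} (hf : f.IsHomogeneous n)
    (G : Matrix (Fin 2) (Fin 2) ℂ) : (linearSubst G f).IsHomogeneous n := by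
  have := hf.aeval (n := 1) (fun i => ∑ j, C (G i j) * X j) fun i =>
    IsHomogeneous.sum _ _ _ fun j _ => by
      simpa using (isHomogeneous_C (Fin 2) (G i j)).mul (isHomogeneous_X ℂ j)
  rwa [one_mul] at this

theorem linearSubst_injective {G : Matrix (Fin 2) (Fin 2) ℂ} (hG : G.det ≠ 0) :
    Function.Injective (linearSubst G) := by
  intro f g h
  refine MvPolynomial.funext fun s => ?_
  have hs : G.mulVec (G⁻¹.mulVec s) = s := by
    rw [Matrix.mulVec_mulVec, Matrix.mul_nonsing_inv _ (IsUnit.mk0 _ hG), Matrix.one_mulVec]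
  rw [← hs, ← eval_linearSubst, h, eval_linearSubst]

/-- A rational normal curve through two distinct points has a parametrisation that maps `[0 : 1]` to
the first and `[1 : 0]` to the second point. -/
theorem IsRationalNormalCurve.exists_veroneseCurve {n : ℕ} {C : Set (PSpace n)}
    (hC : IsRationalNormalCurve C) {P Q : PSpace n} (hP : P ∈ C) (hQ : Q ∈ C) (hPQ : P ≠ Q) :
    ∃ F : Matrix (Fin (n + 1)) (Fin (n + 1)) ℂ, F.det ≠ 0 ∧ C = veroneseCurve F ∧
      (∃ h, P = Projectivization.mk ℂ (F.mulVec (veronese n ![0, 1])) h) ∧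
      (∃ h, Q = Projectivization.mk ℂ (F.mulVec (veronese n ![1, 0])) h) := by
  obtain ⟨f, hf, hi, rfl⟩ := hC
  obtain ⟨s, hs, hs', rfl⟩ := hP
  obtain ⟨t, ht, ht', rfl⟩ := hQ
  -- The columns are `t` and `s`, so that this substitution moves the parameters of `Q` and `P` to
  -- `[1 : 0]` and `[0 : 1]`.
  set G : Matrix (Fin 2) (Fin 2) ℂ := Matrix.of fun i => ![t i, s i] with hGdef
  have hG0 : G.mulVec ![0, 1] = s := by
    ext i
    simp [hGdef, Matrix.mulVec, dotProduct]
  have hG1 : G.mulVec ![1, 0] = t := by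
    ext i
    simp [hGdef, Matrix.mulVec, dotProduct]
  -- If `G` were singular, `s` would be a multiple of `t`, and homogeneity would give equal points.
  have hG : G.det ≠ 0 := by
    intro h0
    obtain ⟨v, hv, hv'⟩ := Matrix.exists_mulVec_eq_zero_iff.2 h0
    have hv2 : ∀ i, v 0 * t i + v 1 * s i = 0 := by
      intro i
      have := congrFun hv' i
      simp only [hGdef, Matrix.mulVec, dotProduct, Fin.sum_univ_two, Matrix.of_apply,
        Matrix.cons_val_zero, Matrix.cons_val_one, Pi.zero_apply] at this
      linear_combination this
    have h1 : v 1 ≠ 0 := by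
      intro h1
      have h0 : v 0 ≠ 0 := by
        intro h0
        exact hv (funext fun i => by fin_cases i <;> assumption)
      refine ht (funext fun i => ?_)
      have := hv2 i
      rw [h1, zero_mul, add_zero] at this
      simpa [h0] using this
    have hst : s = (-(v 0 / v 1)) • t := by
      ext i
      have := hv2 i
      simp only [Pi.smul_apply, smul_eq_mul]
      field_simp
      linear_combination this
    apply hPQ
    rw [Projectivization.mk_eq_mk_iff']
    refine ⟨(-(v 0 / v 1)) ^ n, ?_⟩
    ext i
    rw [hst]
    obtain ⟨F, -, hF⟩ := RNC.exists_veroneseCurve hf hi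
    have h1 := congrFun (hF t) i
    have h2 := congrFun (hF ((-(v 0 / v 1)) • t)) i
    rw [veronese_smul, Matrix.mulVec_smul, Pi.smul_apply] at h2
    rw [Pi.smul_apply]
    exact (congrArg _ h1).trans h2.symm
  obtain ⟨F, hF, hFe⟩ := RNC.exists_veroneseCurve (f := fun i => linearSubst G (f i))
    (fun i => isHomogeneous_linearSubst (hf i) G)
    (hi.map' (linearSubst G).toLinearMap (LinearMap.ker_eq_bot.2 (linearSubst_injective hG)))
  simp only [eval_linearSubst] at hFe
  refine ⟨F, hF, ?_, ?_, ?_⟩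
  · ext x
    constructor
    · rintro ⟨w, hw, h, rfl⟩
      have hs : G.mulVec (G⁻¹.mulVec w) = w := by
        rw [Matrix.mulVec_mulVec, Matrix.mul_nonsing_inv _ (IsUnit.mk0 _ hG), Matrix.one_mulVec]
      have he := hFe (G⁻¹.mulVec w)
      rw [hs] at he
      refine ⟨G⁻¹.mulVec w, fun h0 => hw ?_, he ▸ h, ?_⟩
      · rw [← hs, h0, Matrix.mulVec_zero]
      · congr 1
    · rintro ⟨w, hw, h, rfl⟩
      refine ⟨G.mulVec w, fun h0 => hw (Matrix.eq_zero_of_mulVec_eq_zero hG h0),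
        (hFe w).symm ▸ h, ?_⟩
      congr 1
      exact (hFe w).symm
  · have := hFe ![0, 1]
    rw [hG0] at this
    exact ⟨this ▸ hs', by congr 1⟩
  · have := hFe ![1, 0]
    rw [hG1] at this
    exact ⟨this ▸ ht', by congr 1⟩

end RNC

/-! ### The curve as an adjugate column of a singular matrix pencil, and the genericity expression.
-/

namespace RNC

open Polynomial

section Construction

variable {n : ℕ} {R S : Type*} [CommRing R] [CommRing S]

/-- The polynomial with the given coefficients. -/
noncomputable def rowPoly (u : Fin (n + 1) → R) : R[X] := ∑ k, C (u k) * X ^ (k : ℕ)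

theorem coeff_rowPoly (u : Fin (n + 1) → R) (k : Fin (n + 1)) : (rowPoly u).coeff k = u k := by
  simp [rowPoly, finsetSum_coeff, coeff_X_pow, Fin.val_inj]

theorem natDegree_rowPoly_le (u : Fin (n + 1) → R) : (rowPoly u).natDegree ≤ n :=
  natDegree_sum_le_of_forall_le _ _ fun k _ => (natDegree_C_mul_X_pow_le _ _).trans k.is_le

theorem eq_rowPoly_of_natDegree_le {f : R[X]} (hf : f.natDegree ≤ n) :
    f = rowPoly fun k : Fin (n + 1) => f.coeff k := by
  conv_lhs => rw [f.as_sum_range_C_mul_X_pow' (Nat.lt_succ_of_le hf)]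
  exact Finset.sum_range fun k => C (f.coeff k) * X ^ k

theorem rowPoly_injective : Function.Injective (rowPoly : (Fin (n + 1) → R) → R[X]) := by
  intro u w h
  ext k
  rw [← coeff_rowPoly u, h, coeff_rowPoly]

theorem rowPoly_mul (A F : Matrix (Fin (n + 1)) (Fin (n + 1)) R) (i : Fin (n + 1)) :
    rowPoly ((A * F) i) = ∑ m, C (A i m) * rowPoly (F m) := by
  simp only [rowPoly, Matrix.mul_apply, map_sum, Finset.sum_mul, Finset.mul_sum, map_mul]
  rw [Finset.sum_comm]
  simp only [mul_assoc]

theorem map_rowPoly (f : R →+* S) (u : Fin (n + 1) → R) :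
    (rowPoly u).map f = rowPoly fun k => f (u k) := by
  simp [rowPoly, Polynomial.map_sum]

/-- The row `i` is the member of the `i`-th pencil of linear forms that vanishes at `p`. -/
def pencilMember (φ ψ : Matrix (Fin (n + 1)) (Fin (n + 1)) R) (p : Fin (n + 1) → R) :
    Matrix (Fin (n + 1)) (Fin (n + 1)) R :=
  Matrix.of fun i m => φ.mulVec p i * ψ i m - ψ.mulVec p i * φ i m

theorem pencilMember_mulVec (φ ψ : Matrix (Fin (n + 1)) (Fin (n + 1)) R)
    (p x : Fin (n + 1) → R) (i : Fin (n + 1)) :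
    (pencilMember φ ψ p).mulVec x i =
      φ.mulVec p i * ψ.mulVec x i - ψ.mulVec p i * φ.mulVec x i := by
  simp only [Matrix.mulVec, dotProduct, pencilMember, Matrix.of_apply, sub_mul,
    Finset.sum_sub_distrib, Finset.mul_sum, mul_assoc]

theorem pencilMember_mulVec_self (φ ψ : Matrix (Fin (n + 1)) (Fin (n + 1)) R)
    (p : Fin (n + 1) → R) : (pencilMember φ ψ p).mulVec p = 0 := by
  ext i
  rw [pencilMember_mulVec, Pi.zero_apply]
  ring

/-- The rows of `A` rescaled by the `r`-th row of the adjugate, so that they sum up to zero if `A`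
is singular. -/
def balance (r : Fin (n + 1)) (A : Matrix (Fin (n + 1)) (Fin (n + 1)) R) :
    Matrix (Fin (n + 1)) (Fin (n + 1)) R :=
  Matrix.of fun i m => A.adjugate r i * A i m

theorem balance_mulVec (r : Fin (n + 1)) (A : Matrix (Fin (n + 1)) (Fin (n + 1)) R)
    (x : Fin (n + 1) → R) (i : Fin (n + 1)) :
    (balance r A).mulVec x i = A.adjugate r i * A.mulVec x i := by
  simp only [Matrix.mulVec, dotProduct, balance, Matrix.of_apply, Finset.mul_sum, mul_assoc]

/-- This is row `r` of `adjugate A * A = det A • 1`: for singular `A` an adjugate row is a relation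
among the rows of `A`. -/
theorem sum_balance (r : Fin (n + 1)) {A : Matrix (Fin (n + 1)) (Fin (n + 1)) R}
    (hA : A.det = 0) (m : Fin (n + 1)) : ∑ i, balance r A i m = 0 := by
  have := congrFun (congrFun A.adjugate_mul r) m
  rw [hA, zero_smul, Matrix.zero_apply, Matrix.mul_apply] at this
  exact this

/-- The matrix pencil `A - X B`. -/
noncomputable def pencil (A B : Matrix (Fin (n + 1)) (Fin (n + 1)) R) :
    Matrix (Fin (n + 1)) (Fin (n + 1)) R[X] :=
  A.map C - (X : R[X]) • B.map C

theorem pencil_apply (A B : Matrix (Fin (n + 1)) (Fin (n + 1)) R) (i j : Fin (n + 1)) :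
    pencil A B i j = C (A i j) - X * C (B i j) := rfl

/-- The matrix whose rows are the coefficients of the entries of the first column of the adjugate
of the pencil `A - X B`. -/
noncomputable def curveMatrix (A B : Matrix (Fin (n + 1)) (Fin (n + 1)) R) :
    Matrix (Fin (n + 1)) (Fin (n + 1)) R :=
  Matrix.of fun m k => ((pencil A B).adjugate m 0).coeff k

/-- Adjugate entries are signed `n × n` minors, and the entries of the pencil are linear in `X`.
Hence `curveMatrix` records all coefficients. -/
theorem natDegree_adjugate_pencil_le (A B : Matrix (Fin (n + 1)) (Fin (n + 1)) R)
    (i j : Fin (n + 1)) : ((pencil A B).adjugate i j).natDegree ≤ n := by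
  rw [Matrix.adjugate_fin_succ_eq_det_submatrix]
  have h : (pencil A B).submatrix j.succAbove i.succAbove =
      (X : R[X]) • ((-B).submatrix j.succAbove i.succAbove).map C +
        (A.submatrix j.succAbove i.succAbove).map C := by
    ext1 a b
    simp [pencil_apply]
    ring
  have h1 : ((-1 : R[X]) ^ (j + i : ℕ)).natDegree = 0 := by
    rcases neg_one_pow_eq_or R[X] (j + i : ℕ) with h | h <;> simp [h]
  refine natDegree_mul_le.trans ?_
  rw [h1, zero_add, h]
  simpa using natDegree_det_X_add_C_le ((-B).submatrix j.succAbove i.succAbove)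
    (A.submatrix j.succAbove i.succAbove)

theorem rowPoly_curveMatrix (A B : Matrix (Fin (n + 1)) (Fin (n + 1)) R) (m : Fin (n + 1)) :
    rowPoly (curveMatrix A B m) = (pencil A B).adjugate m 0 :=
  (eq_rowPoly_of_natDegree_le (natDegree_adjugate_pencil_le A B m 0)).symm

/-- The product of the pencil with its adjugate is the determinant times the identity, here zero, so
`A - X B` annihilates the adjugate column. -/
theorem rowPoly_mul_curveMatrix {A B : Matrix (Fin (n + 1)) (Fin (n + 1)) R}
    (h : (pencil A B).det = 0) (i : Fin (n + 1)) :
    rowPoly ((A * curveMatrix A B) i) = X * rowPoly ((B * curveMatrix A B) i) := by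
  rw [rowPoly_mul, rowPoly_mul, ← sub_eq_zero, Finset.mul_sum, ← Finset.sum_sub_distrib]
  have := congrFun (congrFun (pencil A B).mul_adjugate i) 0
  rw [h, zero_smul, Matrix.zero_apply, Matrix.mul_apply] at this
  rw [← this]
  refine Finset.sum_congr rfl fun m _ => ?_
  rw [rowPoly_curveMatrix, pencil_apply]
  ring

/-- The all-ones row vector annihilates `A` and `B`, hence the pencil. -/
theorem det_pencil_eq_zero [IsDomain R] {A B : Matrix (Fin (n + 1)) (Fin (n + 1)) R}
    (hA : ∀ m, ∑ i, A i m = 0) (hB : ∀ m, ∑ i, B i m = 0) : (pencil A B).det = 0 := by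
  rw [← Matrix.exists_vecMul_eq_zero_iff]
  refine ⟨1, one_ne_zero, funext fun m => ?_⟩
  simp only [Matrix.vecMul, dotProduct, pencil_apply, Pi.one_apply, one_mul, Pi.zero_apply,
    Finset.sum_sub_distrib, ← Finset.mul_sum, ← map_sum, hA, hB, map_zero, mul_zero, sub_zero]

/-- The polynomial that vanishes at the parameters of the points on the `i`-th hyperplane of `A`. -/
noncomputable def secantPoly (A B : Matrix (Fin (n + 1)) (Fin (n + 1)) R) (i : Fin (n + 1)) :
    R[X] :=
  rowPoly ((A * curveMatrix A B) i)

/-- Compatibility with ring homomorphisms is what allows `genericity` to be formed over the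
polynomial ring in the coordinates and then evaluated at complex coordinates. -/
theorem map_curveMatrix (f : R →+* S) (A B : Matrix (Fin (n + 1)) (Fin (n + 1)) R) :
    (curveMatrix A B).map f = curveMatrix (A.map f) (B.map f) := by
  ext m k
  have h : (pencil A B).map (mapRingHom f) = pencil (A.map f) (B.map f) := by
    ext1 i j
    simp [pencil_apply]
  have h2 := (mapRingHom f).map_adjugate (pencil A B)
  simp only [RingHom.mapMatrix_apply, h] at h2
  simp only [curveMatrix, Matrix.map_apply, Matrix.of_apply, ← h2, coe_mapRingHom, coeff_map]

theorem map_secantPoly (f : R →+* S) (A B : Matrix (Fin (n + 1)) (Fin (n + 1)) R)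
    (i : Fin (n + 1)) : (secantPoly A B i).map f = secantPoly (A.map f) (B.map f) i := by
  rw [secantPoly, map_rowPoly, secantPoly, ← map_curveMatrix, ← Matrix.map_mul]
  rfl

theorem map_balance (f : R →+* S) (r : Fin (n + 1)) (A : Matrix (Fin (n + 1)) (Fin (n + 1)) R) :
    (balance r A).map f = balance r (A.map f) := by
  have h := f.map_adjugate A
  simp only [RingHom.mapMatrix_apply] at h
  ext i m
  simp [balance, ← h]

theorem map_pencilMember (f : R →+* S) (φ ψ : Matrix (Fin (n + 1)) (Fin (n + 1)) R)
    (p : Fin (n + 1) → R) :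
    (pencilMember φ ψ p).map f = pencilMember (φ.map f) (ψ.map f) (f ∘ p) := by
  ext i m
  simp [pencilMember, RingHom.map_mulVec]

/-- The balanced hyperplanes through the first point. -/
def firstForms (φ ψ : Matrix (Fin (n + 1)) (Fin (n + 1)) R) (p : Fin (n + 1) → R) :
    Matrix (Fin (n + 1)) (Fin (n + 1)) R :=
  -- When the kernel is the line spanned by `p`, row `r` of the adjugate is a multiple of the
  -- relation by a factor proportional to `p r`. Row `0` here and the last row in `secondForms` suit
  -- the witness, where the points are the first and last basis vectors.
  balance 0 (pencilMember φ ψ p)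

/-- The balanced hyperplanes through the second point. -/
def secondForms (φ ψ : Matrix (Fin (n + 1)) (Fin (n + 1)) R) (q : Fin (n + 1) → R) :
    Matrix (Fin (n + 1)) (Fin (n + 1)) R :=
  balance (Fin.last n) (pencilMember φ ψ q)

theorem map_firstForms (f : R →+* S) (φ ψ : Matrix (Fin (n + 1)) (Fin (n + 1)) R)
    (p : Fin (n + 1) → R) :
    (firstForms φ ψ p).map f = firstForms (φ.map f) (ψ.map f) (f ∘ p) := by
  rw [firstForms, map_balance, map_pencilMember, firstForms]

theorem map_secondForms (f : R →+* S) (φ ψ : Matrix (Fin (n + 1)) (Fin (n + 1)) R)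
    (p : Fin (n + 1) → R) :
    (secondForms φ ψ p).map f = secondForms (φ.map f) (ψ.map f) (f ∘ p) := by
  rw [secondForms, map_balance, map_pencilMember, secondForms]

/-- The expression in the coordinates of a datum whose nonvanishing expresses that the datum is in
general position. -/
noncomputable def genericity (φ ψ : Matrix (Fin (n + 1)) (Fin (n + 1)) R)
    (p q : Fin (n + 1) → R) : R :=
  -- The factors ensure in turn: the curve is nondegenerate; both relations have only nonzero
  -- coefficients; the members of the pencil through the two points differ, so neither point is on
  -- the linear space; the secant polynomial has degree `n`; its roots are simple. The degrees in
  -- the resultant are fixed as `n` and `n - 1` so that it commutes with ring homomorphisms.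
  (curveMatrix (firstForms φ ψ p) (secondForms φ ψ q)).det *
    ∏ i, ((pencilMember φ ψ p).adjugate 0 i * (pencilMember φ ψ q).adjugate (Fin.last n) i *
      (pencilMember φ ψ p).mulVec q i *
      (secantPoly (firstForms φ ψ p) (secondForms φ ψ q) i).coeff n *
      resultant (secantPoly (firstForms φ ψ p) (secondForms φ ψ q) i)
        (derivative (secantPoly (firstForms φ ψ p) (secondForms φ ψ q) i)) n (n - 1))

theorem map_genericity (f : R →+* S) (φ ψ : Matrix (Fin (n + 1)) (Fin (n + 1)) R)
    (p q : Fin (n + 1) → R) :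
    f (genericity φ ψ p q) = genericity (φ.map f) (ψ.map f) (f ∘ p) (f ∘ q) := by
  have hadj : ∀ (p : Fin (n + 1) → R) r i, f ((pencilMember φ ψ p).adjugate r i) =
      (pencilMember (φ.map f) (ψ.map f) (f ∘ p)).adjugate r i := by
    intro p r i
    have h := f.map_adjugate (pencilMember φ ψ p)
    simp only [RingHom.mapMatrix_apply, map_pencilMember] at h
    rw [← h]
    rfl
  have hdet : f (curveMatrix (firstForms φ ψ p) (secondForms φ ψ q)).det =
      (curveMatrix (firstForms (φ.map f) (ψ.map f) (f ∘ p))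
        (secondForms (φ.map f) (ψ.map f) (f ∘ q))).det := by
    rw [RingHom.map_det, RingHom.mapMatrix_apply, map_curveMatrix, map_firstForms, map_secondForms]
  have hsec : ∀ i, (secantPoly (firstForms φ ψ p) (secondForms φ ψ q) i).map f =
      secantPoly (firstForms (φ.map f) (ψ.map f) (f ∘ p))
        (secondForms (φ.map f) (ψ.map f) (f ∘ q)) i := by
    intro i
    rw [map_secantPoly, map_firstForms, map_secondForms]
  rw [genericity, genericity, map_mul, map_prod, hdet]
  refine congrArg _ (Finset.prod_congr rfl fun i _ => ?_)
  rw [map_mul, map_mul, map_mul, map_mul, hadj, hadj, RingHom.map_mulVec, map_pencilMember,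
    ← coeff_map, ← resultant_map_map, ← derivative_map, hsec]

end Construction

end RNC

/-! ### Existence: the constructed curve contains the points and is secant to the spaces. -/

namespace RNC

open Polynomial

/-- The adjugate entry is the determinant of `M` with row `r` replaced by the `m`-th coordinate
form. If it is nonzero, a kernel vector is determined by its `m`-th coordinate. -/
theorem exists_eq_smul_of_adjugate_ne_zero {ι K : Type*} [Fintype ι] [DecidableEq ι] [Field K]
    {M : Matrix ι ι K} {m r : ι} (h : M.adjugate m r ≠ 0) {x y : ι → K} (hx : M.mulVec x = 0)
    (hy : M.mulVec y = 0) (hy0 : y ≠ 0) : ∃ a : K, x = a • y := by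
  rw [Matrix.adjugate_apply] at h
  have key : ∀ z : ι → K, M.mulVec z = 0 → z m = 0 → z = 0 := by
    intro z hz hzm
    refine Matrix.eq_zero_of_mulVec_eq_zero h (funext fun i => ?_)
    by_cases hi : i = r
    · subst hi
      simp [Matrix.mulVec, Matrix.updateRow_self, hzm]
    · have := congrFun hz i
      simpa [Matrix.mulVec, Matrix.updateRow_ne hi] using this
  have hym : y m ≠ 0 := fun h0 => hy0 (key y hy h0)
  refine ⟨x m / y m, ?_⟩
  rw [← sub_eq_zero]
  refine key _ ?_ ?_
  · rw [Matrix.mulVec_sub, Matrix.mulVec_smul, hx, hy, smul_zero, sub_zero]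
  · simp [hym]

theorem rowPoly_eval {n : ℕ} (u : Fin (n + 1) → ℂ) (x : ℂ) :
    (rowPoly u).eval x = u ⬝ᵥ veronese n ![x, 1] := by
  simp [rowPoly, eval_finsetSum, dotProduct, veronese]

theorem veronese_one_zero (n : ℕ) : veronese n ![1, 0] = Pi.single (Fin.last n) 1 := by
  ext k
  by_cases hk : k = Fin.last n
  · simp [veronese, hk]
  · have : n - (k : ℕ) ≠ 0 := by
      have := Fin.val_lt_last hk
      omega
    simp [veronese, hk, this]

theorem veronese_zero_one (n : ℕ) : veronese n ![0, 1] = Pi.single 0 1 := by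
  ext k
  by_cases hk : k = 0
  · simp [veronese, hk]
  · have : (k : ℕ) ≠ 0 := fun h => hk (Fin.ext h)
    simp [veronese, hk, this]

theorem eq_smul_of_apply_one_eq_zero {s : Fin 2 → ℂ} (h : s 1 = 0) : s = s 0 • ![1, 0] := by
  ext i
  fin_cases i <;> simp [h]

theorem eq_smul_of_apply_one_ne_zero {s : Fin 2 → ℂ} (h : s 1 ≠ 0) :
    s = s 1 • ![s 0 / s 1, 1] := by
  ext i
  fin_cases i
  · simp [mul_div_cancel₀ _ h]
  · simp

/-- Homogeneous form of an identity `u = X w` of polynomials of degree at most `n`. -/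
theorem mul_dotProduct_veronese {n : ℕ} {u w : Fin (n + 1) → ℂ} (h : rowPoly u = X * rowPoly w)
    (s : Fin 2 → ℂ) : s 1 * (u ⬝ᵥ veronese n s) = s 0 * (w ⬝ᵥ veronese n s) := by
  by_cases hs : s 1 = 0
  · have hw : w (Fin.last n) = 0 := by
      rw [← coeff_rowPoly w, ← coeff_X_mul, ← h]
      exact coeff_eq_zero_of_natDegree_lt (Nat.lt_succ_of_le (natDegree_rowPoly_le u))
    rw [eq_smul_of_apply_one_eq_zero hs, veronese_smul, veronese_one_zero]
    simp [hw]
  · have := congrArg (eval (s 0 / s 1)) h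
    rw [eval_mul, eval_X, rowPoly_eval, rowPoly_eval] at this
    have h2 : veronese n s = s 1 ^ n • veronese n ![s 0 / s 1, 1] := by
      conv_lhs => rw [eq_smul_of_apply_one_ne_zero hs]
      rw [veronese_smul]
    rw [h2, dotProduct_smul, dotProduct_smul, this, smul_eq_mul, smul_eq_mul]
    field_simp

theorem mulVec_veronese_ne_zero {n : ℕ} {F : Matrix (Fin (n + 1)) (Fin (n + 1)) ℂ}
    (hF : F.det ≠ 0) {s : Fin 2 → ℂ} (hs : s ≠ 0) : F.mulVec (veronese n s) ≠ 0 := fun h =>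
  veronese_ne_zero hs (Matrix.eq_zero_of_mulVec_eq_zero hF h)

section GeneralPosition

variable {n : ℕ} {φ ψ : Matrix (Fin (n + 1)) (Fin (n + 1)) ℂ} {p q : Fin (n + 1) → ℂ}

theorem det_curveMatrix_ne_zero (hg : genericity φ ψ p q ≠ 0) :
    (curveMatrix (firstForms φ ψ p) (secondForms φ ψ q)).det ≠ 0 :=
  left_ne_zero_of_mul hg

theorem genericity_factor_ne_zero (hg : genericity φ ψ p q ≠ 0) (i : Fin (n + 1)) :
    (pencilMember φ ψ p).adjugate 0 i ≠ 0 ∧ (pencilMember φ ψ q).adjugate (Fin.last n) i ≠ 0 ∧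
      (pencilMember φ ψ p).mulVec q i ≠ 0 ∧
      (secantPoly (firstForms φ ψ p) (secondForms φ ψ q) i).coeff n ≠ 0 ∧
      resultant (secantPoly (firstForms φ ψ p) (secondForms φ ψ q) i)
        (derivative (secantPoly (firstForms φ ψ p) (secondForms φ ψ q) i)) n (n - 1) ≠ 0 := by
  have h := Finset.prod_ne_zero_iff.1 (right_ne_zero_of_mul hg) i (Finset.mem_univ i)
  simp only [mul_ne_zero_iff] at h
  obtain ⟨⟨⟨⟨h1, h2⟩, h3⟩, h4⟩, h5⟩ := h
  exact ⟨h1, h2, h3, h4, h5⟩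

theorem firstForms_mulVec_eq_zero_iff (hg : genericity φ ψ p q ≠ 0) (x : Fin (n + 1) → ℂ)
    (i : Fin (n + 1)) :
    (firstForms φ ψ p).mulVec x i = 0 ↔ (pencilMember φ ψ p).mulVec x i = 0 := by
  rw [firstForms, balance_mulVec, mul_eq_zero_iff_left (genericity_factor_ne_zero hg i).1]

theorem secondForms_mulVec_eq_zero_iff (hg : genericity φ ψ p q ≠ 0) (x : Fin (n + 1) → ℂ)
    (i : Fin (n + 1)) :
    (secondForms φ ψ q).mulVec x i = 0 ↔ (pencilMember φ ψ q).mulVec x i = 0 := by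
  rw [secondForms, balance_mulVec, mul_eq_zero_iff_left (genericity_factor_ne_zero hg i).2.1]

theorem firstForms_mulVec_self (i : Fin (n + 1)) : (firstForms φ ψ p).mulVec p i = 0 := by
  rw [firstForms, balance_mulVec, pencilMember_mulVec_self, Pi.zero_apply, mul_zero]

theorem secondForms_mulVec_self (i : Fin (n + 1)) : (secondForms φ ψ q).mulVec q i = 0 := by
  rw [secondForms, balance_mulVec, pencilMember_mulVec_self, Pi.zero_apply, mul_zero]

theorem det_pencilMember (hp : p ≠ 0) : (pencilMember φ ψ p).det = 0 :=
  Matrix.exists_mulVec_eq_zero_iff.1 ⟨p, hp, pencilMember_mulVec_self φ ψ p⟩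

theorem sum_firstForms (hp : p ≠ 0) (m : Fin (n + 1)) : ∑ i, firstForms φ ψ p i m = 0 :=
  sum_balance 0 (det_pencilMember hp) m

theorem sum_secondForms (hq : q ≠ 0) (m : Fin (n + 1)) : ∑ i, secondForms φ ψ q i m = 0 :=
  sum_balance _ (det_pencilMember hq) m

theorem secantPoly_eq_X_mul (hp : p ≠ 0) (hq : q ≠ 0) (i : Fin (n + 1)) :
    secantPoly (firstForms φ ψ p) (secondForms φ ψ q) i =
      X * rowPoly ((secondForms φ ψ q * curveMatrix (firstForms φ ψ p) (secondForms φ ψ q)) i) :=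
  rowPoly_mul_curveMatrix (det_pencil_eq_zero (sum_firstForms hp) (sum_secondForms hq)) i

theorem forms_mulVec_curve (hp : p ≠ 0) (hq : q ≠ 0) (s : Fin 2 → ℂ) (i : Fin (n + 1)) :
    s 1 * (firstForms φ ψ p).mulVec
        ((curveMatrix (firstForms φ ψ p) (secondForms φ ψ q)).mulVec (veronese n s)) i =
      s 0 * (secondForms φ ψ q).mulVec
        ((curveMatrix (firstForms φ ψ p) (secondForms φ ψ q)).mulVec (veronese n s)) i := by
  rw [Matrix.mulVec_mulVec, Matrix.mulVec_mulVec]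
  exact mul_dotProduct_veronese (secantPoly_eq_X_mul hp hq i) s

/-- The points where the pencils of hyperplanes meet for a given parameter lie on the curve. -/
theorem exists_eq_smul_curve (hg : genericity φ ψ p q ≠ 0) (hp : p ≠ 0) (hq : q ≠ 0)
    {s : Fin 2 → ℂ} (hs : s ≠ 0) {x : Fin (n + 1) → ℂ}
    (hx : ∀ i, s 1 * (firstForms φ ψ p).mulVec x i = s 0 * (secondForms φ ψ q).mulVec x i) :
    ∃ a : ℂ, x =
      a • (curveMatrix (firstForms φ ψ p) (secondForms φ ψ q)).mulVec (veronese n s) := by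
  have hw := forms_mulVec_curve (φ := φ) (ψ := ψ) hp hq s
  have hw0 := mulVec_veronese_ne_zero (det_curveMatrix_ne_zero hg) hs
  -- At `[1 : 0]` only the forms through `q` remain, and their kernel is a line by the factor
  -- attached to `q`. For other `s` the matrix is `M` below; its adjugate column is the point of the
  -- curve itself, so it is nonzero and the kernel is again a line.
  by_cases h1 : s 1 = 0
  · have h0 : s 0 ≠ 0 := by
      intro h0
      exact hs (funext fun i => by fin_cases i <;> assumption)
    refine exists_eq_smul_of_adjugate_ne_zero (genericity_factor_ne_zero hg 0).2.1
      (funext fun i => ?_) (funext fun i => ?_) hw0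
    · have := hx i
      rw [h1, zero_mul, eq_comm, mul_eq_zero_iff_left h0] at this
      exact (secondForms_mulVec_eq_zero_iff hg x i).1 this
    · have := hw i
      rw [h1, zero_mul, eq_comm, mul_eq_zero_iff_left h0] at this
      exact (secondForms_mulVec_eq_zero_iff hg _ i).1 this
  · set F := curveMatrix (firstForms φ ψ p) (secondForms φ ψ q) with hF
    set M := firstForms φ ψ p - (s 0 / s 1) • secondForms φ ψ q with hM
    have hker : ∀ y : Fin (n + 1) → ℂ,
        (∀ i, s 1 * (firstForms φ ψ p).mulVec y i = s 0 * (secondForms φ ψ q).mulVec y i) →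
          M.mulVec y = 0 := by
      intro y hy
      ext i
      have := hy i
      rw [hM, Matrix.sub_mulVec, Matrix.smul_mulVec, Pi.sub_apply, Pi.smul_apply, smul_eq_mul,
        Pi.zero_apply]
      field_simp
      linear_combination this
    have hadj : ∀ m, M.adjugate m 0 = F.mulVec (veronese n ![s 0 / s 1, 1]) m := by
      intro m
      have h2 := (evalRingHom (s 0 / s 1)).map_adjugate
        (pencil (firstForms φ ψ p) (secondForms φ ψ q))
      have h3 : (evalRingHom (s 0 / s 1)).mapMatrix
          (pencil (firstForms φ ψ p) (secondForms φ ψ q)) = M := by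
        ext i j
        simp [pencil_apply, hM, -X_mul_C]
      rw [h3] at h2
      rw [← h2, RingHom.mapMatrix_apply, Matrix.map_apply, ← rowPoly_curveMatrix, coe_evalRingHom,
        rowPoly_eval]
      rfl
    obtain ⟨m, hm⟩ := Function.ne_iff.1
      (mulVec_veronese_ne_zero (det_curveMatrix_ne_zero hg) (s := ![s 0 / s 1, 1])
        fun h => one_ne_zero (congrFun h 1))
    refine exists_eq_smul_of_adjugate_ne_zero (m := m) (r := 0) ?_ (hker x hx) (hker _ hw) hw0
    rw [hadj]
    exact hm

theorem mk_mem_veroneseCurve {F : Matrix (Fin (n + 1)) (Fin (n + 1)) ℂ} (hF : F.det ≠ 0)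
    {s : Fin 2 → ℂ} (hs : s ≠ 0) {x : Fin (n + 1) → ℂ} (hx : x ≠ 0)
    (h : ∃ a : ℂ, x = a • F.mulVec (veronese n s)) :
    Projectivization.mk ℂ x hx ∈ veroneseCurve F := by
  obtain ⟨a, ha⟩ := h
  exact ⟨s, hs, mulVec_veronese_ne_zero hF hs,
    (Projectivization.mk_eq_mk_iff' ℂ _ _ _ _).2 ⟨a, ha.symm⟩⟩

theorem first_mem_curve (hg : genericity φ ψ p q ≠ 0) (hp : p ≠ 0) (hq : q ≠ 0) :
    Projectivization.mk ℂ p hp ∈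
      veroneseCurve (curveMatrix (firstForms φ ψ p) (secondForms φ ψ q)) := by
  have hs : (![0, 1] : Fin 2 → ℂ) ≠ 0 := fun h => one_ne_zero (congrFun h 1)
  refine mk_mem_veroneseCurve (det_curveMatrix_ne_zero hg) hs hp
    (exists_eq_smul_curve hg hp hq hs fun i => ?_)
  simp [firstForms_mulVec_self]

theorem second_mem_curve (hg : genericity φ ψ p q ≠ 0) (hp : p ≠ 0) (hq : q ≠ 0) :
    Projectivization.mk ℂ q hq ∈
      veroneseCurve (curveMatrix (firstForms φ ψ p) (secondForms φ ψ q)) := by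
  have hs : (![1, 0] : Fin 2 → ℂ) ≠ 0 := fun h => one_ne_zero (congrFun h 0)
  refine mk_mem_veroneseCurve (det_curveMatrix_ne_zero hg) hs hq
    (exists_eq_smul_curve hg hp hq hs fun i => ?_)
  simp [secondForms_mulVec_self]

/-- The two members of the pencil are combinations of the two equations, with determinant
`(pencilMember φ ψ p).mulVec q i`. -/
theorem equations_iff (hg : genericity φ ψ p q ≠ 0) (x : Fin (n + 1) → ℂ) (i : Fin (n + 1)) :
    (φ.mulVec x i = 0 ∧ ψ.mulVec x i = 0) ↔
      ((pencilMember φ ψ p).mulVec x i = 0 ∧ (pencilMember φ ψ q).mulVec x i = 0) := by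
  have hΔ := (genericity_factor_ne_zero hg i).2.2.1
  rw [pencilMember_mulVec] at hΔ
  rw [pencilMember_mulVec, pencilMember_mulVec]
  constructor
  · rintro ⟨h1, h2⟩
    simp [h1, h2]
  · rintro ⟨h1, h2⟩
    constructor
    · refine (mul_eq_zero_iff_left hΔ).1 ?_
      linear_combination φ.mulVec q i * h1 - φ.mulVec p i * h2
    · refine (mul_eq_zero_iff_left hΔ).1 ?_
      linear_combination ψ.mulVec q i * h1 - ψ.mulVec p i * h2

/-- The coefficient factor makes the degree exactly `n`, so the resultant with formal degrees is the
true one; its nonvanishing gives separability, and over `ℂ` there are `n` distinct roots. -/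
theorem card_roots_secantPoly (hg : genericity φ ψ p q ≠ 0) (i : Fin (n + 1)) :
    (secantPoly (firstForms φ ψ p) (secondForms φ ψ q) i).roots.toFinset.card = n := by
  obtain ⟨-, -, -, h4, h5⟩ := genericity_factor_ne_zero hg i
  set f := secantPoly (firstForms φ ψ p) (secondForms φ ψ q) i with hf
  have hdeg : f.natDegree = n :=
    le_antisymm (natDegree_rowPoly_le _) (le_natDegree_of_ne_zero h4)
  have hsep : f.Separable := by
    by_contra hns
    have h6 : resultant f (derivative f) = 0 := by
      rw [resultant_eq_zero_iff]
      refine ⟨Or.inl fun h0 => h4 (by rw [h0, coeff_zero]), hns⟩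
    rw [natDegree_derivative, hdeg] at h6
    exact h5 h6
  rw [Multiset.toFinset_card_of_nodup (nodup_roots hsep),
    ← (IsAlgClosed.splits f).natDegree_eq_card_roots, hdeg]

/-- Coordinate `0` of the Veronese vectors forces `a = 1`, and coordinate `1`, available as `1 ≤ n`,
is the parameter. -/
theorem parameter_injective (hn : 1 ≤ n) {F : Matrix (Fin (n + 1)) (Fin (n + 1)) ℂ}
    (hF : F.det ≠ 0) {x y a : ℂ}
    (h : F.mulVec (veronese n ![x, 1]) = a • F.mulVec (veronese n ![y, 1])) : x = y := by
  rw [← Matrix.mulVec_smul] at h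
  have h2 := Matrix.mulVec_injective_of_isUnit ((Matrix.isUnit_iff_isUnit_det F).2 (IsUnit.mk0 _ hF)) h
  have h0 := congrFun h2 0
  have h1 := congrFun h2 ⟨1, by omega⟩
  simp [veronese] at h0 h1
  rw [← h0, one_mul] at h1
  exact h1

theorem isSecant_curve (hn : 1 ≤ n) (hg : genericity φ ψ p q ≠ 0) (hp : p ≠ 0) (hq : q ≠ 0)
    {L : Submodule ℂ (Fin (n + 1) → ℂ)} {i : Fin (n + 1)}
    (hL : ∀ x, x ∈ L ↔ φ.mulVec x i = 0 ∧ ψ.mulVec x i = 0) :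
    IsSecant (n - 1) (veroneseCurve (curveMatrix (firstForms φ ψ p) (secondForms φ ψ q))) L := by
  obtain ⟨-, -, hΔ, h4, -⟩ := genericity_factor_ne_zero hg i
  set F := curveMatrix (firstForms φ ψ p) (secondForms φ ψ q) with hFdef
  have hF : F.det ≠ 0 := det_curveMatrix_ne_zero hg
  set f := secantPoly (firstForms φ ψ p) (secondForms φ ψ q) i with hf
  have hf0 : f ≠ 0 := fun h0 => h4 (by rw [h0, coeff_zero])
  have hne : ∀ x : ℂ, F.mulVec (veronese n ![x, 1]) ≠ 0 := fun x =>
    mulVec_veronese_ne_zero hF fun h => one_ne_zero (congrFun h 1)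
  have hpΛ : ∀ a : ℂ, a • p ∈ L → a • p = 0 := by
    intro a ha
    by_contra h0
    have ha0 : a ≠ 0 := fun h => h0 (by rw [h, zero_smul])
    obtain ⟨h1, h2⟩ := (hL p).1 ((L.smul_mem_iff ha0).1 ha)
    rw [pencilMember_mulVec, h1, h2] at hΔ
    simp at hΔ
  have hqΛ : ∀ a : ℂ, a • q ∈ L → a • q = 0 := by
    intro a ha
    by_contra h0
    have ha0 : a ≠ 0 := fun h => h0 (by rw [h, zero_smul])
    obtain ⟨h1, h2⟩ := (hL q).1 ((L.smul_mem_iff ha0).1 ha)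
    rw [pencilMember_mulVec, h1, h2] at hΔ
    simp at hΔ
  have hmem : ∀ x : Fin (n + 1) → ℂ, x ∈ L ↔
      (firstForms φ ψ p).mulVec x i = 0 ∧ (secondForms φ ψ q).mulVec x i = 0 := by
    intro x
    rw [hL, equations_iff hg, firstForms_mulVec_eq_zero_iff hg, secondForms_mulVec_eq_zero_iff hg]
  have heval : ∀ x, f.eval x = (firstForms φ ψ p).mulVec (F.mulVec (veronese n ![x, 1])) i := by
    intro x
    rw [hf, secantPoly, rowPoly_eval, Matrix.mulVec_mulVec]
    rfl
  set g : ℂ → PSpace n := fun x => Projectivization.mk ℂ _ (hne x) with hgdef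
  have hginj : Function.Injective g := by
    intro x y h
    obtain ⟨a, ha⟩ := (Projectivization.mk_eq_mk_iff' ℂ _ _ _ _).1 h
    exact parameter_injective hn hF ha.symm
  -- The parameters `[1 : 0]` and `[0 : 1]` belong to `q` and `p`, which are not on `L`. At a root
  -- `x ≠ 0` of `f` the first form vanishes, and then so does the second, since `x` times its value
  -- equals that of the first.
  have himage : pointSet L ∩ veroneseCurve F = g '' (f.roots.toFinset.erase 0 : Finset ℂ) := by
    ext y
    constructor
    · rintro ⟨hy, s, hs, hs', rfl⟩
      rw [pointSet, Set.mem_ofPred_eq, Projectivization.submodule_mk,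
        Submodule.span_singleton_le_iff_mem] at hy
      have h1 : s 1 ≠ 0 := by
        intro h1
        obtain ⟨a, ha⟩ := exists_eq_smul_curve hg hp hq hs (x := q) fun i => by
          rw [h1, secondForms_mulVec_self]; ring
        have ha0 : a ≠ 0 := fun h => hq (by rw [ha, h, zero_smul])
        have h2 : F.mulVec (veronese n s) = a⁻¹ • q := by
          rw [ha, smul_smul, inv_mul_cancel₀ ha0, one_smul]
        rw [h2] at hy hs'
        exact hs' (hqΛ _ hy)
      have h0 : s 0 ≠ 0 := by
        intro h0
        obtain ⟨a, ha⟩ := exists_eq_smul_curve hg hp hq hs (x := p) fun i => by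
          rw [h0, firstForms_mulVec_self]; ring
        have ha0 : a ≠ 0 := fun h => hp (by rw [ha, h, zero_smul])
        have h2 : F.mulVec (veronese n s) = a⁻¹ • p := by
          rw [ha, smul_smul, inv_mul_cancel₀ ha0, one_smul]
        rw [h2] at hy hs'
        exact hs' (hpΛ _ hy)
      have h2 : F.mulVec (veronese n s) = s 1 ^ n • F.mulVec (veronese n ![s 0 / s 1, 1]) := by
        conv_lhs => rw [eq_smul_of_apply_one_ne_zero h1]
        rw [veronese_smul, Matrix.mulVec_smul]
      rw [h2, L.smul_mem_iff (pow_ne_zero _ h1)] at hy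
      refine ⟨s 0 / s 1, ?_, ?_⟩
      · simp only [Finset.coe_erase, Set.mem_sdiff, Finset.mem_coe, Multiset.mem_toFinset,
          Set.mem_singleton_iff]
        refine ⟨(mem_roots hf0).2 ?_, div_ne_zero h0 h1⟩
        rw [IsRoot.def, heval]
        exact ((hmem _).1 hy).1
      · exact ((Projectivization.mk_eq_mk_iff' ℂ _ _ _ _).2 ⟨_, h2.symm⟩).symm
    · rintro ⟨x, hx, rfl⟩
      simp only [Finset.coe_erase, Set.mem_sdiff, Finset.mem_coe, Multiset.mem_toFinset,
        Set.mem_singleton_iff, mem_roots hf0, IsRoot.def, heval] at hx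
      refine ⟨?_, mk_mem_veroneseCurve hF (s := ![x, 1]) (fun h => one_ne_zero (congrFun h 1))
        (hne x) ⟨1, (one_smul _ _).symm⟩⟩
      rw [pointSet, Set.mem_ofPred_eq, Projectivization.submodule_mk,
        Submodule.span_singleton_le_iff_mem, hmem]
      refine ⟨hx.1, ?_⟩
      have := forms_mulVec_curve (φ := φ) (ψ := ψ) hp hq ![x, 1] i
      rw [hx.1, mul_zero, eq_comm] at this
      exact (mul_eq_zero_iff_left hx.2).1 this
  -- Discarding the root of `p` leaves `n - 1` of the `n` roots.
  have hzero : (0 : ℂ) ∈ f.roots.toFinset := by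
    rw [Multiset.mem_toFinset, mem_roots hf0, IsRoot.def, hf, secantPoly_eq_X_mul hp hq, eval_mul,
      eval_X, zero_mul]
  rw [IsSecant, himage, hginj.encard_image, Set.encard_coe_eq_coe_finsetCard,
    Finset.card_erase_of_mem hzero, card_roots_secantPoly hg]

end GeneralPosition

end RNC

/-! ### Uniqueness: every secant curve through the points is the constructed one. -/

namespace RNC

open Polynomial

/-- Among polynomials of degree at most `n` vanishing on `T`, one with zero `n`-th coefficient has
degree below `n` and at least `n` roots, so it is zero. This space is thus at most one-dimensional.
-/
theorem exists_eq_C_mul_of_common_roots {K : Type*} [Field K] {n : ℕ} {f g : K[X]}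
    (hf : f.natDegree ≤ n) (hg : g.natDegree ≤ n) (hf0 : f ≠ 0) (hg0 : g ≠ 0) {T : Finset K}
    (hT : n ≤ T.card) (hfT : ∀ x ∈ T, f.eval x = 0) (hgT : ∀ x ∈ T, g.eval x = 0) :
    ∃ e : K, e ≠ 0 ∧ g = C e * f := by
  have key : ∀ h : K[X], h.natDegree ≤ n → h.coeff n = 0 → (∀ x ∈ T, h.eval x = 0) → h = 0 := by
    intro h hd hc hr
    refine eq_zero_of_degree_lt_of_eval_finset_eq_zero T ?_ hr
    rw [degree_lt_iff_coeff_zero]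
    intro m hm
    rcases (hT.trans hm).eq_or_lt with rfl | h'
    · exact hc
    · exact coeff_eq_zero_of_natDegree_lt (hd.trans_lt h')
  have hfc : f.coeff n ≠ 0 := fun h => hf0 (key f hf h hfT)
  have hgc : g.coeff n ≠ 0 := fun h => hg0 (key g hg h hgT)
  refine ⟨g.coeff n / f.coeff n, div_ne_zero hgc hfc, ?_⟩
  rw [← sub_eq_zero]
  refine key _ ((natDegree_sub_le _ _).trans (max_le hg ((natDegree_C_mul_le _ _).trans hf))) ?_ ?_
  · rw [coeff_sub, coeff_C_mul, div_mul_cancel₀ _ hfc, sub_self]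
  · intro x hx
    simp [hfT x hx, hgT x hx]

theorem natDegree_X_mul_rowPoly_le {n : ℕ} {R : Type*} [CommRing R] {w : Fin (n + 1) → R}
    (hw : w (Fin.last n) = 0) : (X * rowPoly w).natDegree ≤ n := by
  rw [natDegree_le_iff_coeff_eq_zero]
  intro m hm
  obtain ⟨m, rfl⟩ : ∃ k, m = k + 1 := ⟨m - 1, by omega⟩
  rw [coeff_X_mul]
  rcases (Nat.le_of_lt_succ hm).eq_or_lt with rfl | h
  · exact (coeff_rowPoly w (Fin.last n)).trans hw
  · exact coeff_eq_zero_of_natDegree_lt ((natDegree_rowPoly_le w).trans_lt h)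

theorem rowPoly_ne_zero {n : ℕ} {R : Type*} [CommRing R] {w : Fin (n + 1) → R} (hw : w ≠ 0) :
    rowPoly w ≠ 0 := fun h => hw (rowPoly_injective (h.trans (by simp [rowPoly])))

/-- The parameters of the points in which a linear space that avoids the points with parameters
`[0 : 1]` and `[1 : 0]` meets the curve. -/
theorem exists_parameters {n k : ℕ} {F : Matrix (Fin (n + 1)) (Fin (n + 1)) ℂ} (hF : F.det ≠ 0)
    {L : Submodule ℂ (Fin (n + 1) → ℂ)} (hL : IsSecant k (veroneseCurve F) L)
    (h0 : F.mulVec (veronese n ![0, 1]) ∉ L) (h1 : F.mulVec (veronese n ![1, 0]) ∉ L) :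
    ∃ T : Finset ℂ, T.card = k ∧ ∀ x ∈ T, x ≠ 0 ∧ F.mulVec (veronese n ![x, 1]) ∈ L := by
  have hne : ∀ x : ℂ, F.mulVec (veronese n ![x, 1]) ≠ 0 := fun x =>
    mulVec_veronese_ne_zero hF fun h => one_ne_zero (congrFun h 1)
  set Z : Set ℂ := {x | x ≠ 0 ∧ F.mulVec (veronese n ![x, 1]) ∈ L} with hZ
  have hsub : pointSet L ∩ veroneseCurve F ⊆
      (fun x => Projectivization.mk ℂ _ (hne x)) '' Z := by
    rintro y ⟨hy, s, hs, hs', rfl⟩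
    rw [pointSet, Set.mem_ofPred_eq, Projectivization.submodule_mk,
      Submodule.span_singleton_le_iff_mem] at hy
    have hs1 : s 1 ≠ 0 := by
      intro hs1
      have hs0 : s 0 ≠ 0 := fun hs0 => hs (funext fun i => by fin_cases i <;> assumption)
      rw [eq_smul_of_apply_one_eq_zero hs1, veronese_smul, Matrix.mulVec_smul,
        L.smul_mem_iff (pow_ne_zero _ hs0)] at hy
      exact h1 hy
    have h2 : F.mulVec (veronese n s) = s 1 ^ n • F.mulVec (veronese n ![s 0 / s 1, 1]) := by
      conv_lhs => rw [eq_smul_of_apply_one_ne_zero hs1]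
      rw [veronese_smul, Matrix.mulVec_smul]
    rw [h2, L.smul_mem_iff (pow_ne_zero _ hs1)] at hy
    refine ⟨s 0 / s 1, ⟨fun h => ?_, hy⟩,
      ((Projectivization.mk_eq_mk_iff' ℂ _ _ _ _).2 ⟨_, h2.symm⟩).symm⟩
    rw [h] at hy
    exact h0 hy
  -- A lower bound suffices, as a subset with exactly `k` elements is chosen; injectivity of the
  -- parametrisation is not needed.
  have hcard : (k : ℕ∞) ≤ Z.encard := by
    rw [← hL]
    exact (Set.encard_le_encard hsub).trans (Set.encard_image_le _ _)
  obtain ⟨T, hTZ, hT⟩ := Set.exists_subset_encard_eq hcard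
  have hfin : T.Finite := Set.finite_of_encard_eq_coe hT
  refine ⟨hfin.toFinset, ?_, fun x hx => hTZ (hfin.mem_toFinset.1 hx)⟩
  rw [hfin.encard_eq_coe_toFinset_card] at hT
  exact_mod_cast hT

section Uniqueness

variable {n : ℕ} {φ ψ : Matrix (Fin (n + 1)) (Fin (n + 1)) ℂ} {p q : Fin (n + 1) → ℂ}

/-- A secant curve through the two points is the locus where the pencils of hyperplanes, suitably
parametrised, meet. -/
theorem exists_pencil_parameters (hn : 1 ≤ n) (hg : genericity φ ψ p q ≠ 0)
    (hp : p ≠ 0) (hq : q ≠ 0) {L : Fin (n + 1) → Submodule ℂ (Fin (n + 1) → ℂ)}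
    (hL : ∀ i x, x ∈ L i ↔ φ.mulVec x i = 0 ∧ ψ.mulVec x i = 0)
    {F : Matrix (Fin (n + 1)) (Fin (n + 1)) ℂ} (hF : F.det ≠ 0)
    (hsec : ∀ i, IsSecant (n - 1) (veroneseCurve F) (L i))
    {a b : ℂ} (ha : a ≠ 0) (hb : b ≠ 0) (hpF : F.mulVec (veronese n ![0, 1]) = a • p)
    (hqF : F.mulVec (veronese n ![1, 0]) = b • q) :
    ∃ κ : ℂ, κ ≠ 0 ∧ ∀ (s : Fin 2 → ℂ) (i : Fin (n + 1)),
      κ * s 1 * (firstForms φ ψ p).mulVec (F.mulVec (veronese n s)) i =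
        s 0 * (secondForms φ ψ q).mulVec (F.mulVec (veronese n s)) i := by
  set A := pencilMember φ ψ p with hA
  set B := pencilMember φ ψ q with hB
  have hΔ : ∀ i, A.mulVec q i ≠ 0 := fun i => (genericity_factor_ne_zero hg i).2.2.1
  have hΔ' : ∀ i, B.mulVec p i ≠ 0 := by
    intro i h
    refine hΔ i ?_
    rw [hA, pencilMember_mulVec]
    rw [hB, pencilMember_mulVec] at h
    linear_combination -h
  have hpL : ∀ i, p ∉ L i := fun i h =>
    hΔ' i ((equations_iff hg p i).1 ((hL i p).1 h)).2
  have hqL : ∀ i, q ∉ L i := fun i h =>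
    hΔ i ((equations_iff hg q i).1 ((hL i q).1 h)).1
  have hrow : ∀ (M : Matrix (Fin (n + 1)) (Fin (n + 1)) ℂ) (x : Fin (n + 1) → ℂ) i,
      M.mulVec x i ≠ 0 → rowPoly ((M * F) i) ≠ 0 := by
    intro M x i h
    refine rowPoly_ne_zero fun h0 => h ?_
    have h1 : Matrix.vecMul (M i) F = 0 := h0
    have h2 : M i = 0 := Matrix.eq_zero_of_vecMul_eq_zero hF h1
    simp [Matrix.mulVec, h2]
  have hAF0 : ∀ i, (A * F) i 0 = 0 := by
    intro i
    have h1 := congrFun (congrArg A.mulVec hpF) i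
    rw [Matrix.mulVec_smul, hA, pencilMember_mulVec_self, veronese_zero_one, Matrix.mulVec_mulVec]
      at h1
    simpa using h1
  have hBFn : ∀ i, (B * F) i (Fin.last n) = 0 := by
    intro i
    have h1 := congrFun (congrArg B.mulVec hqF) i
    rw [Matrix.mulVec_smul, hB, pencilMember_mulVec_self, veronese_one_zero, Matrix.mulVec_mulVec]
      at h1
    simpa using h1
  have heval : ∀ (M : Matrix (Fin (n + 1)) (Fin (n + 1)) ℂ) i x,
      (rowPoly ((M * F) i)).eval x = M.mulVec (F.mulVec (veronese n ![x, 1])) i := by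
    intro M i x
    rw [rowPoly_eval, Matrix.mulVec_mulVec]
    rfl
  -- Both sides have degree at most `n` and share `n` roots: the `n - 1` secant parameters, and `0`,
  -- which is a root of the right side because `A` kills `p`.
  have hprop : ∀ i, ∃ e : ℂ, e ≠ 0 ∧
      X * rowPoly ((B * F) i) = C e * rowPoly ((A * F) i) := by
    intro i
    obtain ⟨T, hT, hTL⟩ := exists_parameters hF (hsec i)
      (by rw [hpF, (L i).smul_mem_iff ha]; exact hpL i)
      (by rw [hqF, (L i).smul_mem_iff hb]; exact hqL i)
    have h0T : (0 : ℂ) ∉ T := fun h => (hTL 0 h).1 rfl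
    have hTAB : ∀ x ∈ T, (rowPoly ((A * F) i)).eval x = 0 ∧ (rowPoly ((B * F) i)).eval x = 0 := by
      intro x hx
      rw [heval, heval]
      exact (equations_iff hg _ i).1 ((hL i _).1 (hTL x hx).2)
    refine exists_eq_C_mul_of_common_roots (T := insert 0 T) (natDegree_rowPoly_le _)
      (natDegree_X_mul_rowPoly_le (hBFn i)) (hrow A q i (hΔ i))
      (mul_ne_zero X_ne_zero (hrow B p i (hΔ' i))) ?_ ?_ ?_
    · rw [Finset.card_insert_of_notMem h0T]
      omega
    · intro x hx
      rcases Finset.mem_insert.1 hx with rfl | hx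
      · rw [← coeff_zero_eq_eval_zero]
        exact (coeff_rowPoly _ 0).trans (hAF0 i)
      · exact (hTAB x hx).1
    · intro x hx
      rcases Finset.mem_insert.1 hx with rfl | hx
      · rw [eval_mul, eval_X, zero_mul]
      · rw [eval_mul, (hTAB x hx).2, mul_zero]
  choose e he heq using hprop
  have hcoef : ∀ i (m : Fin (n + 1)), e i * (A * F) i m = (X * rowPoly ((B * F) i)).coeff m := by
    intro i m
    rw [heq, coeff_C_mul, coeff_rowPoly]
  have hβ : Matrix.vecMul (fun i => B.adjugate (Fin.last n) i) B = 0 := by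
    ext m
    exact sum_secondForms (φ := φ) (ψ := ψ) hq m
  have hα : Matrix.vecMul (fun i => A.adjugate 0 i) A = 0 := by
    ext m
    exact sum_firstForms (φ := φ) (ψ := ψ) hp m
  -- The relation among the rows of `B`, applied to `e i * (A * F) i = X * (B * F) i`, kills the
  -- right side; `F` is then cancelled.
  have hβe : Matrix.vecMul (fun i => B.adjugate (Fin.last n) i * e i) A = 0 := by
    refine Matrix.eq_zero_of_vecMul_eq_zero hF ?_
    rw [Matrix.vecMul_vecMul]
    ext m
    have h1 : Matrix.vecMul (fun i => B.adjugate (Fin.last n) i) (B * F) = 0 := by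
      rw [← Matrix.vecMul_vecMul, hβ, Matrix.zero_vecMul]
    simp only [Matrix.vecMul, dotProduct, mul_assoc, hcoef, Pi.zero_apply]
    rcases Nat.eq_zero_or_pos (m : ℕ) with hm | hm
    · simp [hm]
    · obtain ⟨k, hk⟩ : ∃ k : Fin (n + 1), (m : ℕ) = k + 1 :=
        ⟨⟨m - 1, by omega⟩, by simp only; omega⟩
      have h2 := congrFun h1 k
      simp only [hk, coeff_X_mul, coeff_rowPoly]
      exact h2
  -- A nonzero adjugate entry makes the relation among the rows of `A` unique up to a scalar, so the
  -- relation just found is `κ` times the adjugate row.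
  obtain ⟨κ, hκ⟩ := exists_eq_smul_of_adjugate_ne_zero (M := A.transpose) (m := 0) (r := 0)
    (by rw [← Matrix.adjugate_transpose]; exact (genericity_factor_ne_zero hg 0).1)
    (by rw [Matrix.mulVec_transpose]; exact hβe) (by rw [Matrix.mulVec_transpose]; exact hα)
    (fun h => (genericity_factor_ne_zero hg 0).1 (congrFun h 0))
  have hκi : ∀ i, B.adjugate (Fin.last n) i * e i = κ * A.adjugate 0 i := fun i => congrFun hκ i
  refine ⟨κ, fun h => ?_, fun s i => ?_⟩
  · have := hκi 0
    rw [h, zero_mul] at this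
    exact mul_ne_zero (genericity_factor_ne_zero hg 0).2.1 (he 0) this
  · have hpoly : rowPoly (e i • (A * F) i) = X * rowPoly ((B * F) i) := by
      rw [heq]
      simp [rowPoly, Finset.mul_sum, mul_assoc]
    have h1 := mul_dotProduct_veronese hpoly s
    rw [smul_dotProduct, smul_eq_mul] at h1
    have h2 : ∀ M : Matrix (Fin (n + 1)) (Fin (n + 1)) ℂ,
        (M * F) i ⬝ᵥ veronese n s = M.mulVec (F.mulVec (veronese n s)) i := by
      intro M
      rw [Matrix.mulVec_mulVec]
      rfl
    rw [h2, h2] at h1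
    rw [firstForms, secondForms, balance_mulVec, balance_mulVec]
    linear_combination B.adjugate (Fin.last n) i * h1 -
      s 1 * A.mulVec (F.mulVec (veronese n s)) i * hκi i

/-- The two curves are cut out by the same balanced pencils and differ only by the reparametrisation
`[s₀ : s₁] ↦ [s₀ : κ s₁]`. -/
theorem eq_curve_of_isSecant (hn : 1 ≤ n) (hg : genericity φ ψ p q ≠ 0)
    (hp : p ≠ 0) (hq : q ≠ 0) {L : Fin (n + 1) → Submodule ℂ (Fin (n + 1) → ℂ)}
    (hL : ∀ i x, x ∈ L i ↔ φ.mulVec x i = 0 ∧ ψ.mulVec x i = 0)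
    {C : Set (PSpace n)} (hC : IsRationalNormalCurve C)
    (hpC : Projectivization.mk ℂ p hp ∈ C) (hqC : Projectivization.mk ℂ q hq ∈ C)
    (hsec : ∀ i, IsSecant (n - 1) C (L i)) :
    C = veroneseCurve (curveMatrix (firstForms φ ψ p) (secondForms φ ψ q)) := by
  have hpq : Projectivization.mk ℂ p hp ≠ Projectivization.mk ℂ q hq := by
    intro h
    obtain ⟨a, ha⟩ := (Projectivization.mk_eq_mk_iff' ℂ _ _ _ _).1 h.symm
    refine (genericity_factor_ne_zero hg 0).2.2.1 ?_
    rw [← ha, Matrix.mulVec_smul, pencilMember_mulVec_self, smul_zero, Pi.zero_apply]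
  obtain ⟨F, hF, rfl, ⟨h0, hpF⟩, ⟨h1, hqF⟩⟩ := hC.exists_veroneseCurve hpC hqC hpq
  obtain ⟨a, ha⟩ := (Projectivization.mk_eq_mk_iff' ℂ _ _ _ _).1 hpF.symm
  obtain ⟨b, hb⟩ := (Projectivization.mk_eq_mk_iff' ℂ _ _ _ _).1 hqF.symm
  obtain ⟨κ, hκ, hpar⟩ := exists_pencil_parameters hn hg hp hq hL hF hsec
    (fun h => h0 (by rw [← ha, h, zero_smul])) (fun h => h1 (by rw [← hb, h, zero_smul]))
    ha.symm hb.symm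
  have hs' : ∀ (c : ℂ) {s : Fin 2 → ℂ}, c ≠ 0 → s ≠ 0 → ![s 0, c * s 1] ≠ 0 := by
    intro c s hc hs h
    have h0 : s 0 = 0 := congrFun h 0
    have h1 : c * s 1 = 0 := congrFun h 1
    refine hs (funext fun i => ?_)
    fin_cases i
    · exact h0
    · exact (mul_eq_zero_iff_left hc).1 h1
  ext y
  constructor
  · rintro ⟨s, hs, hy, rfl⟩
    exact mk_mem_veroneseCurve (det_curveMatrix_ne_zero hg) (hs' κ hκ hs) hy
      (exists_eq_smul_curve hg hp hq (hs' κ hκ hs) fun i => hpar s i)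
  · rintro ⟨s, hs, hy, rfl⟩
    have hs2 := hs' κ⁻¹ (inv_ne_zero hκ) hs
    obtain ⟨c, hc⟩ := exists_eq_smul_curve hg hp hq hs
      (x := F.mulVec (veronese n ![s 0, κ⁻¹ * s 1])) fun i => by
        have := hpar ![s 0, κ⁻¹ * s 1] i
        simpa [hκ] using this
    exact ⟨_, hs2, mulVec_veronese_ne_zero hF hs2,
      ((Projectivization.mk_eq_mk_iff' ℂ _ _ _ _).2 ⟨c, hc.symm⟩).symm⟩

end Uniqueness

end RNC

/-! ### A datum at which the genericity expression is nonzero. -/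

namespace RNC

open Polynomial

section Witness

variable {n : ℕ}

theorem det_ne_zero_of_rowPoly {M : Matrix (Fin (n + 1)) (Fin (n + 1)) ℂ}
    (h : ∀ v : Fin (n + 1) → ℂ, ∑ i, C (v i) * rowPoly (M i) = 0 → v = 0) : M.det ≠ 0 := by
  intro h0
  obtain ⟨v, hv, hv'⟩ := Matrix.exists_vecMul_eq_zero_iff.2 h0
  refine hv (h v ?_)
  have h1 := rowPoly_mul (Matrix.of fun _ : Fin (n + 1) => v) M 0
  have h2 : (Matrix.of (fun _ : Fin (n + 1) => v) * M) 0 = 0 := hv'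
  rw [h2] at h1
  simpa [rowPoly] using h1.symm

/-- Any `n` of the `n + 1` polynomials are linearly independent. -/
def AlmostIndependent (g : Fin (n + 1) → ℂ[X]) : Prop :=
  ∀ (i : Fin (n + 1)) (c : Fin (n + 1) → ℂ), c i = 0 → ∑ j, C (c j) * g j = 0 → c = 0

/-- The entry is the determinant of `M` with row `i` replaced by the row of `X ^ k`. The remaining
rows are `h` times `n` independent polynomials, and `hk` says that `X ^ k` is not of the form `h *
f` with `f` of degree at most `n - 1`. -/
theorem AlmostIndependent.adjugate_ne_zero {g : Fin (n + 1) → ℂ[X]} (hg : AlmostIndependent g)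
    {M : Matrix (Fin (n + 1)) (Fin (n + 1)) ℂ} {r : Fin (n + 1) → ℂ} (hr : ∀ i, r i ≠ 0)
    {h : ℂ[X]} (hh : h ≠ 0) {k : Fin (n + 1)} (hM : ∀ i, rowPoly (M i) = C (r i) * (h * g i))
    (hk : ∀ (a : ℂ) (f : ℂ[X]), C a * X ^ (k : ℕ) + h * f = 0 → f.natDegree ≤ n - 1 → a = 0)
    (hdeg : ∀ i, (g i).natDegree ≤ n - 1) (i : Fin (n + 1)) : M.adjugate k i ≠ 0 := by
  rw [Matrix.adjugate_apply]
  refine det_ne_zero_of_rowPoly fun v hv => ?_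
  have hsingle : rowPoly (Pi.single k (1 : ℂ)) = X ^ (k : ℕ) := by
    rw [rowPoly, Finset.sum_eq_single k]
    · simp
    · intro j _ hj
      simp [hj]
    · simp
  rw [← Finset.add_sum_erase _ _ (Finset.mem_univ i), Matrix.updateRow_self, hsingle] at hv
  set w : Fin (n + 1) → ℂ := fun j => if j = i then 0 else v j * r j with hw
  have hsum : ∑ j ∈ Finset.univ.erase i, C (v j) * rowPoly (M.updateRow i (Pi.single k 1) j) =
      h * ∑ j, C (w j) * g j := by
    rw [← Finset.add_sum_erase _ _ (Finset.mem_univ i), mul_add, Finset.mul_sum]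
    have hwi : w i = 0 := if_pos rfl
    rw [hwi, C_0, zero_mul, mul_zero, zero_add]
    refine Finset.sum_congr rfl fun j hj => ?_
    have hji := Finset.ne_of_mem_erase hj
    have hwj : w j = v j * r j := if_neg hji
    rw [Matrix.updateRow_ne hji, hM, hwj, C_mul]
    ring
  rw [hsum] at hv
  have hvi : v i = 0 := hk _ _ hv (natDegree_sum_le_of_forall_le _ _ fun j _ =>
    (natDegree_C_mul_le _ _).trans (hdeg j))
  rw [hvi, C_0, zero_mul, zero_add, mul_eq_zero_iff_left hh] at hv
  have hw0 := hg i w (if_pos rfl) hv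
  ext j
  by_cases hj : j = i
  · rw [hj, hvi, Pi.zero_apply]
  · have := congrFun hw0 j
    simp only [hw, if_neg hj, Pi.zero_apply] at this
    exact (mul_eq_zero_iff_right (hr j)).1 this

/-- The rows of `A - x B` are all divisible by `X - κ x`, so its kernel is spanned by the Veronese
vector of `κ x`, and the adjugate column is a multiple of that vector. -/
theorem curveMatrix_eq_diagonal {g : Fin (n + 1) → ℂ[X]} (hg : AlmostIndependent g)
    (hdeg : ∀ i, (g i).natDegree ≤ n - 1)
    {A B : Matrix (Fin (n + 1)) (Fin (n + 1)) ℂ} {r : Fin (n + 1) → ℂ} {κ : ℂ}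
    (hr : ∀ i, r i ≠ 0) (hA : ∀ i, rowPoly (A i) = C (r i) * (X * g i))
    (hB : ∀ i, rowPoly (B i) = C (κ * r i) * g i) :
    ∃ a : ℂ, a ≠ 0 ∧ curveMatrix A B = Matrix.diagonal fun m : Fin (n + 1) => a * κ ^ (m : ℕ) := by
  set M : ℂ → Matrix (Fin (n + 1)) (Fin (n + 1)) ℂ := fun x => A - x • B with hM
  have hrow : ∀ x i, rowPoly (M x i) = C (r i) * ((X - C (κ * x)) * g i) := by
    intro x i
    have : rowPoly (M x i) = rowPoly (A i) - C x * rowPoly (B i) := by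
      simp only [rowPoly, hM, Matrix.sub_apply, Matrix.smul_apply, smul_eq_mul, C_sub, C_mul,
        sub_mul, Finset.sum_sub_distrib, Finset.mul_sum, mul_assoc]
    rw [this, hA, hB, C_mul, C_mul]
    ring
  have hadj : ∀ x m, (M x).adjugate m 0 = (rowPoly (curveMatrix A B m)).eval x := by
    intro x m
    have h2 := (evalRingHom x).map_adjugate (pencil A B)
    have h3 : (evalRingHom x).mapMatrix (pencil A B) = M x := by
      ext i j
      simp [pencil_apply, hM, -X_mul_C]
    rw [h3] at h2
    rw [← h2, rowPoly_curveMatrix]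
    rfl
  have hne : ∀ x, (rowPoly (curveMatrix A B 0)).eval x ≠ 0 := by
    intro x
    rw [← hadj]
    refine hg.adjugate_ne_zero hr (X_sub_C_ne_zero (κ * x)) (hrow x) (fun a f h _ => ?_) hdeg 0
    have := congrArg (eval (κ * x)) h
    simpa using this
  have hker : ∀ x, (M x).mulVec (veronese n ![κ * x, 1]) = 0 := by
    intro x
    ext i
    have h1 : (M x).mulVec (veronese n ![κ * x, 1]) i = (rowPoly (M x i)).eval (κ * x) :=
      (rowPoly_eval _ _).symm
    rw [h1, hrow]
    simp
  have hver : ∀ x, veronese n ![κ * x, 1] ≠ 0 := fun x =>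
    veronese_ne_zero fun h => one_ne_zero (congrFun h 1)
  have hprop : ∀ x m, (rowPoly (curveMatrix A B m)).eval x =
      (rowPoly (curveMatrix A B 0)).eval x * (κ * x) ^ (m : ℕ) := by
    intro x m
    have hdet : (M x).det = 0 := Matrix.exists_mulVec_eq_zero_iff.1 ⟨_, hver x, hker x⟩
    have hcol : (M x).mulVec (fun m => (M x).adjugate m 0) = 0 := by
      ext i
      have := congrFun (congrFun (M x).mul_adjugate i) 0
      rw [hdet, zero_smul] at this
      exact this
    obtain ⟨a, ha⟩ := exists_eq_smul_of_adjugate_ne_zero (by rw [hadj]; exact hne x) hcol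
      (hker x) (hver x)
    have h0 := congrFun ha 0
    have h1 := congrFun ha m
    simp only [hadj, Pi.smul_apply, veronese, smul_eq_mul, Matrix.cons_val_zero,
      Matrix.cons_val_one, one_pow, mul_one, Fin.val_zero, pow_zero] at h0 h1
    rw [h1, h0]
  -- The proportionality factor is a polynomial in `x` without complex zeros, hence constant.
  obtain ⟨a, ha⟩ : ∃ a, rowPoly (curveMatrix A B 0) = C a := by
    refine ⟨_, eq_C_of_degree_eq_zero ?_⟩
    by_contra hd
    obtain ⟨x, hx⟩ := IsAlgClosed.exists_root _ hd
    exact hne x hx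
  refine ⟨a, fun h => hne 0 (by rw [ha, h, eval_C]), ?_⟩
  have hpoly : ∀ m, rowPoly (curveMatrix A B m) = C (a * κ ^ (m : ℕ)) * X ^ (m : ℕ) := by
    intro m
    refine Polynomial.funext fun x => ?_
    rw [hprop, ha]
    simp only [eval_C, eval_mul, eval_pow, eval_X, mul_pow]
    ring
  ext m k
  rw [← coeff_rowPoly (curveMatrix A B m) k, hpoly, coeff_C_mul, coeff_X_pow, Matrix.diagonal_apply]
  simp [Fin.ext_iff, eq_comm]

theorem secantPoly_eq_comp {A B : Matrix (Fin (n + 1)) (Fin (n + 1)) ℂ} {a κ : ℂ}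
    (h : curveMatrix A B = Matrix.diagonal fun m : Fin (n + 1) => a * κ ^ (m : ℕ)) (i : Fin (n + 1)) :
    secantPoly A B i = C a * (rowPoly (A i)).comp (C κ * X) := by
  rw [secantPoly, h]
  simp only [rowPoly, Matrix.mul_diagonal, Finset.mul_sum, Polynomial.comp, eval₂_finsetSum, eval₂_mul, eval₂_C,
    eval₂_X_pow, mul_pow, C_mul, C_pow]
  exact Finset.sum_congr rfl fun k _ => by ring

theorem separable_comp_C_mul_X {f : ℂ[X]} (hf : f.Separable) {κ : ℂ} (hκ : κ ≠ 0) :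
    (f.comp (C κ * X)).Separable := by
  have h : IsCoprime (f.comp (C κ * X)) ((derivative f).comp (C κ * X)) :=
    IsCoprime.map hf (compRingHom (C κ * X))
  rw [Polynomial.Separable, derivative_comp]
  simp only [derivative_mul, derivative_C, derivative_X, zero_mul, zero_add, mul_one]
  exact (isCoprime_mul_unit_left_right (isUnit_C.2 (IsUnit.mk0 _ hκ)) _ _).2 h

theorem resultant_derivative_ne_zero {f : ℂ[X]} (hf : f.Separable) (hd : f.natDegree = n) :
    resultant f (derivative f) n (n - 1) ≠ 0 := by
  intro h
  have h2 : resultant f (derivative f) = 0 := by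
    rw [natDegree_derivative, hd, h]
  exact (resultant_eq_zero_iff.1 h2).2 hf

/-- A datum of general position: the linear spaces are secant to the standard rational normal
curve, in the points whose parameters are the roots of `g i`. -/
theorem genericity_ne_zero (hn : 1 ≤ n) {g : Fin (n + 1) → ℂ[X]} (hg : AlmostIndependent g)
    (hmonic : ∀ i, (g i).Monic) (hdeg : ∀ i, (g i).natDegree = n - 1)
    (hsep : ∀ i, (X * g i).Separable) :
    genericity (Matrix.of fun i (m : Fin (n + 1)) => (g i).coeff m)
      (Matrix.of fun i (m : Fin (n + 1)) => (X * g i).coeff m)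
      (Pi.single 0 1) (Pi.single (Fin.last n) 1) ≠ 0 := by
  set φ : Matrix (Fin (n + 1)) (Fin (n + 1)) ℂ := Matrix.of fun i m => (g i).coeff m with hφ
  set ψ : Matrix (Fin (n + 1)) (Fin (n + 1)) ℂ := Matrix.of fun i m => (X * g i).coeff m with hψ
  set p : Fin (n + 1) → ℂ := Pi.single 0 1 with hp
  set q : Fin (n + 1) → ℂ := Pi.single (Fin.last n) 1 with hq
  have hp0 : p ≠ 0 := by simp [hp]
  have hq0 : q ≠ 0 := by simp [hq]
  have hXn : ∀ i, (X * g i).coeff n = 1 := by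
    intro i
    obtain ⟨k, hk⟩ : ∃ k, n = k + 1 := ⟨n - 1, by omega⟩
    have := (hmonic i).coeff_natDegree
    rw [hdeg] at this
    rw [hk, coeff_X_mul]
    rwa [hk] at this
  -- Otherwise `X ^ 2` would divide the separable polynomial `X * g i`.
  have hg0 : ∀ i, (g i).coeff 0 ≠ 0 := by
    intro i h
    have h1 : X ∣ g i := X_dvd_iff.2 h
    exact not_isUnit_X ((hsep i).squarefree X (mul_dvd_mul_left X h1))
  have hφr : ∀ i, rowPoly (φ i) = g i := fun i =>
    (eq_rowPoly_of_natDegree_le (by rw [hdeg]; omega)).symm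
  have hψr : ∀ i, rowPoly (ψ i) = X * g i := by
    intro i
    have h : (X * g i).natDegree ≤ n := by
      rw [natDegree_X_mul (hmonic i).ne_zero, hdeg]
      omega
    exact (eq_rowPoly_of_natDegree_le h).symm
  have hA0 : ∀ i m, pencilMember φ ψ p i m = (g i).coeff 0 * ψ i m := by
    intro i m
    simp [pencilMember, hφ, hψ, hp]
  have hB0 : ∀ i m, pencilMember φ ψ q i m = -1 * φ i m := by
    intro i m
    have : (g i).coeff n = 0 := coeff_eq_zero_of_natDegree_lt (by rw [hdeg]; omega)
    simp [pencilMember, hφ, hψ, hq, hXn, this]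
  have hsmul : ∀ (c : ℂ) (u w : Fin (n + 1) → ℂ), (∀ m, u m = c * w m) →
      rowPoly u = C c * rowPoly w := by
    intro c u w h
    simp only [rowPoly, h, C_mul, Finset.mul_sum, mul_assoc]
  have hα : ∀ i, (pencilMember φ ψ p).adjugate 0 i ≠ 0 := by
    refine hg.adjugate_ne_zero (r := fun i => (g i).coeff 0) hg0 X_ne_zero (fun i => ?_)
      (fun a f h _ => ?_) fun i => (hdeg i).le
    · rw [hsmul _ _ _ (hA0 i), hψr]
    · have := congrArg (eval 0) h
      simpa using this
  have hβ : ∀ i, (pencilMember φ ψ q).adjugate (Fin.last n) i ≠ 0 := by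
    refine hg.adjugate_ne_zero (r := fun _ => -1) (fun _ => by norm_num) one_ne_zero (fun i => ?_)
      (fun a f h hf => ?_) fun i => (hdeg i).le
    · rw [hsmul _ _ _ (hB0 i), hφr, one_mul]
    · have h1 := congrArg (fun f => coeff f n) h
      have h2 : f.coeff n = 0 := coeff_eq_zero_of_natDegree_lt (by omega)
      simpa [h2] using h1
  set r : Fin (n + 1) → ℂ := fun i => (pencilMember φ ψ p).adjugate 0 i * (g i).coeff 0 with hr
  have hr0 : ∀ i, r i ≠ 0 := fun i => mul_ne_zero (hα i) (hg0 i)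
  set b : Fin (n + 1) → ℂ := fun i => -(pencilMember φ ψ q).adjugate (Fin.last n) i with hb
  have hA : ∀ i, rowPoly (firstForms φ ψ p i) = C (r i) * (X * g i) := by
    intro i
    rw [hsmul (r i) _ (ψ i), hψr]
    intro m
    simp only [firstForms, balance, Matrix.of_apply, hA0, hr]
    ring
  have hB : ∀ i, rowPoly (secondForms φ ψ q i) = C (b i) * g i := by
    intro i
    rw [hsmul (b i) _ (φ i), hφr]
    intro m
    simp only [secondForms, balance, Matrix.of_apply, hB0, hb]
    ring
  have hsum : ∀ M : Matrix (Fin (n + 1)) (Fin (n + 1)) ℂ, (∀ m, ∑ i, M i m = 0) →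
      ∑ i, rowPoly (M i) = 0 := by
    intro M hM
    simp only [rowPoly]
    rw [Finset.sum_comm]
    simp only [← Finset.sum_mul, ← map_sum, hM, map_zero, zero_mul, Finset.sum_const_zero]
  have hrel1 : ∑ i, C (r i) * g i = 0 := by
    have := hsum _ (sum_firstForms (φ := φ) (ψ := ψ) hp0)
    simp only [hA, mul_left_comm _ X, ← Finset.mul_sum] at this
    exact (mul_eq_zero_iff_left X_ne_zero).1 this
  have hrel2 : ∑ i, C (b i) * g i = 0 := by
    have := hsum _ (sum_secondForms (φ := φ) (ψ := ψ) hq0)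
    simpa only [hB] using this
  -- `r` and `b` are both relations among the `g i`; the combination with zero entry at `0` vanishes
  -- by almost independence, so they are proportional.
  have hbr : ∀ i, b i = b 0 / r 0 * r i := by
    intro i
    have h1 := hg 0 (fun i => r 0 * b i - b 0 * r i) (by ring) (by
      simp only [C_sub, C_mul, sub_mul, Finset.sum_sub_distrib, mul_assoc, ← Finset.mul_sum,
        hrel1, hrel2, mul_zero, sub_zero])
    have h2 := congrFun h1 i
    simp only [Pi.zero_apply] at h2
    have := hr0 0
    field_simp
    linear_combination h2
  have hκ : b 0 / r 0 ≠ 0 := div_ne_zero (neg_ne_zero.2 (hβ 0)) (hr0 0)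
  obtain ⟨a, ha, hF⟩ := curveMatrix_eq_diagonal hg (fun i => (hdeg i).le) hr0 hA
    (B := secondForms φ ψ q) (κ := b 0 / r 0) (fun i => by rw [hB, ← hbr])
  have hsecant := fun i => secantPoly_eq_comp hF i
  refine mul_ne_zero ?_ (Finset.prod_ne_zero_iff.2 fun i _ => ?_)
  · rw [hF, Matrix.det_diagonal]
    exact Finset.prod_ne_zero_iff.2 fun i _ => mul_ne_zero ha (pow_ne_zero _ hκ)
  · have hcoeff : (secantPoly (firstForms φ ψ p) (secondForms φ ψ q) i).coeff n ≠ 0 := by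
      rw [hsecant, coeff_C_mul, comp_C_mul_X_coeff, hA, coeff_C_mul, hXn]
      exact mul_ne_zero ha (mul_ne_zero (mul_ne_zero (hr0 i) one_ne_zero) (pow_ne_zero _ hκ))
    refine mul_ne_zero (mul_ne_zero (mul_ne_zero (mul_ne_zero (hα i) (hβ i)) ?_) hcoeff) ?_
    · have : (pencilMember φ ψ p).mulVec q i = (g i).coeff 0 := by
        rw [hq, Matrix.mulVec_single_one, Matrix.col_apply, hA0, hψ, Matrix.of_apply, Fin.val_last,
          hXn, mul_one]
      rw [this]
      exact hg0 i
    · refine resultant_derivative_ne_zero ?_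
        (le_antisymm (natDegree_rowPoly_le _) (le_natDegree_of_ne_zero hcoeff))
      rw [hsecant, hA, mul_comp, C_comp, ← mul_assoc, ← C_mul]
      exact (separable_comp_C_mul_X (hsep i) hκ).unit_mul
        (isUnit_C.2 (IsUnit.mk0 _ (mul_ne_zero ha (hr0 i))))

/-- The parameters of the points of the `i`-th linear space of the witness. -/
def witnessParameters (n i : ℕ) : Finset ℕ :=
  -- The first `n` polynomials are of Lagrange type for the nodes `1, …, n`; the last has all its
  -- roots away from these nodes.
  if i < n then (Finset.Icc 1 n).erase (i + 1) else Finset.Icc (n + 1) (2 * n - 1)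

theorem card_witnessParameters (n i : ℕ) : (witnessParameters n i).card = n - 1 := by
  unfold witnessParameters
  split_ifs with h
  · rw [Finset.card_erase_of_mem (Finset.mem_Icc.2 ⟨by omega, by omega⟩), Nat.card_Icc]
    omega
  · rw [Nat.card_Icc]
    omega

theorem zero_notMem_witnessParameters (n i : ℕ) : 0 ∉ witnessParameters n i := by
  unfold witnessParameters
  split_ifs <;> simp

/-- The polynomial whose roots are the given natural numbers. -/
noncomputable def rootsPoly (s : Finset ℕ) : ℂ[X] := ∏ a ∈ s, (X - C (a : ℂ))

theorem eval_rootsPoly_eq_zero_iff (s : Finset ℕ) (x : ℕ) :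
    (rootsPoly s).eval (x : ℂ) = 0 ↔ x ∈ s := by
  simp [rootsPoly, eval_prod, Finset.prod_eq_zero_iff, sub_eq_zero]

theorem almostIndependent_rootsPoly :
    AlmostIndependent fun i : Fin (n + 1) => rootsPoly (witnessParameters n i) := by
  intro i c hci hc
  have heval : ∀ x : ℕ, ∑ j, c j * (rootsPoly (witnessParameters n j)).eval (x : ℂ) = 0 := by
    intro x
    have := congrArg (eval (x : ℂ)) hc
    simpa [eval_finsetSum] using this
  have hvanish : ∀ j k : Fin (n + 1), (j : ℕ) < n → (k : ℕ) < n → k ≠ j →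
      (rootsPoly (witnessParameters n k)).eval ((j + 1 : ℕ) : ℂ) = 0 := by
    intro j k hj hk hkj
    rw [eval_rootsPoly_eq_zero_iff, witnessParameters, if_pos hk, Finset.mem_erase, Finset.mem_Icc]
    have : (k : ℕ) ≠ j := fun h => hkj (Fin.ext h)
    omega
  -- At the node `i + 1` of the omitted index, only the last polynomial contributes. With its
  -- coefficient gone, each other node isolates one coefficient.
  have hlast : c (Fin.last n) = 0 := by
    by_cases hi : i = Fin.last n
    · rw [← hi, hci]
    · have hin : (i : ℕ) < n := Fin.val_lt_last hi
      have h1 := heval (i + 1)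
      rw [Finset.sum_eq_single (Fin.last n)] at h1
      · refine (mul_eq_zero_iff_right fun h => ?_).1 h1
        rw [eval_rootsPoly_eq_zero_iff, witnessParameters, if_neg (by simp), Finset.mem_Icc] at h
        omega
      · intro k _ hk
        by_cases hki : k = i
        · rw [hki, hci, zero_mul]
        · rw [hvanish i k hin (Fin.val_lt_last hk) hki, mul_zero]
      · simp
  ext j
  by_cases hj : j = Fin.last n
  · rw [hj, hlast, Pi.zero_apply]
  · have hjn : (j : ℕ) < n := Fin.val_lt_last hj
    have h1 := heval (j + 1)
    rw [Finset.sum_eq_single j] at h1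
    · refine (mul_eq_zero_iff_right fun h => ?_).1 h1
      rw [eval_rootsPoly_eq_zero_iff, witnessParameters, if_pos hjn] at h
      simp at h
    · intro k _ hkj
      by_cases hk : k = Fin.last n
      · rw [hk, hlast, zero_mul]
      · rw [hvanish j k hjn (Fin.val_lt_last hk) hkj, mul_zero]
    · simp

theorem exists_genericity_ne_zero (hn : 1 ≤ n) :
    ∃ (φ ψ : Matrix (Fin (n + 1)) (Fin (n + 1)) ℂ) (p q : Fin (n + 1) → ℂ),
      genericity φ ψ p q ≠ 0 := by
  refine ⟨_, _, _, _, genericity_ne_zero hn almostIndependent_rootsPoly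
    (fun i => monic_prod_of_monic _ _ fun a _ => monic_X_sub_C _) (fun i => ?_) fun i => ?_⟩
  · rw [rootsPoly, natDegree_prod_of_monic _ _ fun a _ => monic_X_sub_C _]
    simp only [natDegree_X_sub_C, Finset.sum_const, card_witnessParameters, smul_eq_mul, mul_one]
  · have h : X * rootsPoly (witnessParameters n i) =
        rootsPoly (insert 0 (witnessParameters n i)) := by
      rw [rootsPoly, rootsPoly, Finset.prod_insert (zero_notMem_witnessParameters n i)]
      simp
    rw [h, rootsPoly, separable_prod_X_sub_C_iff']
    intro a _ b _ hab
    exact_mod_cast hab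

end Witness

end RNC

/-! ### The genericity polynomial and the proof of the theorem. -/

namespace RNC

/-- The coefficients of the `k`-th equations of the linear spaces. -/
def equationMatrix {n p : ℕ} {R : Type*} (c : CoordIndex n (n + 1) p → R) (k : Fin 2) :
    Matrix (Fin (n + 1)) (Fin (n + 1)) R :=
  Matrix.of fun i m => c (Sum.inl (i, k, m))

/-- The homogeneous coordinates of the `j`-th point. -/
def pointVector {n l p : ℕ} {R : Type*} (c : CoordIndex n l p → R) (j : Fin p) : Fin (n + 1) → R :=
  fun m => c (Sum.inr (j, m))

/-- The genericity condition as a polynomial in the coordinates. -/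
noncomputable def genericityPolynomial (n : ℕ) : MvPolynomial (CoordIndex n (n + 1) 2) ℂ :=
  genericity (equationMatrix MvPolynomial.X 0) (equationMatrix MvPolynomial.X 1)
    (pointVector MvPolynomial.X 0) (pointVector MvPolynomial.X 1)

theorem eval_genericityPolynomial {n : ℕ} (c : CoordIndex n (n + 1) 2 → ℂ) :
    MvPolynomial.eval c (genericityPolynomial n) =
      genericity (equationMatrix c 0) (equationMatrix c 1) (pointVector c 0) (pointVector c 1) := by
  have hm : ∀ k, (equationMatrix MvPolynomial.X k).map (MvPolynomial.eval c) =
      equationMatrix c k := by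
    intro k
    ext i m
    simp [equationMatrix]
  have hv : ∀ j, MvPolynomial.eval c ∘ pointVector MvPolynomial.X j = pointVector c j := by
    intro j
    ext m
    simp [pointVector]
  rw [genericityPolynomial, map_genericity, hm, hm, hv, hv]

theorem equationMap_apply_eq {n p : ℕ} (c : CoordIndex n (n + 1) p → ℂ) (i : Fin (n + 1))
    (x : Fin (n + 1) → ℂ) (k : Fin 2) :
    equationMap c i x k = (equationMatrix c k).mulVec x i := rfl

/-- Coordinates in general position are the coordinates of a datum. -/
theorem exists_hasCoords {n : ℕ} {c : CoordIndex n (n + 1) 2 → ℂ}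
    (hc : genericity (equationMatrix c 0) (equationMatrix c 1) (pointVector c 0)
      (pointVector c 1) ≠ 0) : ∃ δ : Datum n (n + 1) 2, δ.HasCoords c := by
  have hΔ := fun i => (genericity_factor_ne_zero hc i).2.2.1
  have hsurj : ∀ i, Function.Surjective (equationMap c i) := by
    intro i y
    have hi := hΔ i
    rw [pencilMember_mulVec, ← equationMap_apply_eq, ← equationMap_apply_eq, ← equationMap_apply_eq,
      ← equationMap_apply_eq] at hi
    set u := equationMap c i (pointVector c 0) with hu
    set v := equationMap c i (pointVector c 1) with hv
    -- Cramer's rule: the values `u` and `v` of the equations at the two points form a basis of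
    -- `ℂ²`, their determinant being a factor of `genericity`.
    refine ⟨((y 0 * v 1 - y 1 * v 0) / (u 0 * v 1 - u 1 * v 0)) • pointVector c 0 +
      ((u 0 * y 1 - u 1 * y 0) / (u 0 * v 1 - u 1 * v 0)) • pointVector c 1, ?_⟩
    rw [map_add, map_smul, map_smul, ← hu, ← hv]
    ext k
    fin_cases k
    · simp only [Fin.zero_eta, Pi.add_apply, Pi.smul_apply, smul_eq_mul]
      rw [div_mul_eq_mul_div, div_mul_eq_mul_div, ← add_div, div_eq_iff hi]
      ring
    · simp only [Fin.mk_one, Pi.add_apply, Pi.smul_apply, smul_eq_mul]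
      rw [div_mul_eq_mul_div, div_mul_eq_mul_div, ← add_div, div_eq_iff hi]
      ring
  have hpoint : ∀ j, pointVector c j ≠ 0 := by
    intro j h
    refine hΔ 0 ?_
    rw [pencilMember_mulVec]
    fin_cases j
    · simp only [Fin.zero_eta] at h
      simp [h]
    · simp only [Fin.mk_one] at h
      simp [h]
  refine ⟨⟨fun i => ⟨LinearMap.ker (equationMap c i), ?_⟩,
    fun j => Projectivization.mk ℂ (pointVector c j) (hpoint j)⟩, fun i x => ?_, fun j => ?_⟩
  · rw [(equationMap c i).quotKerEquivRange.finrank_eq, LinearMap.range_eq_top.2 (hsurj i)]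
    simp
  · rw [LinearMap.mem_ker, funext_iff]
    simp [equationMap_apply]
  · rw [Projectivization.submodule_mk]
    rfl

theorem Datum.HasCoords.exists_point_eq {n l p : ℕ} {δ : Datum n l p} {c : CoordIndex n l p → ℂ}
    (h : δ.HasCoords c) (j : Fin p) :
    ∃ hj : pointVector c j ≠ 0, δ.points j = Projectivization.mk ℂ (pointVector c j) hj := by
  have h1 := h.2 j
  have h0 : pointVector c j ≠ 0 := by
    intro h0
    have h2 := (δ.points j).finrank_submodule
    have h3 : (fun m => c (Sum.inr (j, m))) = 0 := h0
    rw [h1, h3, Submodule.span_zero_singleton, finrank_bot] at h2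
    exact zero_ne_one h2
  refine ⟨h0, Projectivization.submodule_injective ?_⟩
  rw [h1, Projectivization.submodule_mk]
  rfl

end RNC

theorem proposition4p5 (n : ℕ) (hn : 1 ≤ n) :
    RNC.HoldsForGeneric (fun δ : RNC.Datum n (n + 1) 2 =>
      ∃! C : Set (RNC.PSpace n),
        RNC.IsRationalNormalCurve C ∧
        (∀ j, δ.points j ∈ C) ∧
        (∀ i, RNC.IsSecant (n - 1) C (δ.spaces i).1)) := by
  refine RNC.holdsForGeneric_of_eval_ne_zero (RNC.genericityPolynomial n) ?_ fun δ c h hc => ?_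
  · obtain ⟨φ, ψ, p, q, hg⟩ := RNC.exists_genericity_ne_zero hn
    set c : RNC.CoordIndex n (n + 1) 2 → ℂ :=
      Sum.elim (fun a => (![φ, ψ] a.2.1) a.1 a.2.2) (fun b => ![p, q] b.1 b.2) with hcdef
    have hc : RNC.genericity (RNC.equationMatrix c 0) (RNC.equationMatrix c 1)
        (RNC.pointVector c 0) (RNC.pointVector c 1) ≠ 0 := hg
    obtain ⟨δ, hδ⟩ := RNC.exists_hasCoords hc
    exact ⟨δ, c, hδ, by rwa [RNC.eval_genericityPolynomial]⟩
  · rw [RNC.eval_genericityPolynomial] at hc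
    obtain ⟨hp, hpe⟩ := h.exists_point_eq 0
    obtain ⟨hq, hqe⟩ := h.exists_point_eq 1
    have hL : ∀ i x, x ∈ (δ.spaces i).1 ↔ (RNC.equationMatrix c 0).mulVec x i = 0 ∧
        (RNC.equationMatrix c 1).mulVec x i = 0 := by
      intro i x
      rw [h.mem_iff, funext_iff, Fin.forall_fin_two]
      rfl
    refine ⟨_, ⟨RNC.isRationalNormalCurve_veroneseCurve (RNC.det_curveMatrix_ne_zero hc), ?_,
      fun i => RNC.isSecant_curve hn hc hp hq (hL i)⟩, ?_⟩
    · rw [Fin.forall_fin_two, hpe, hqe]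
      exact ⟨RNC.first_mem_curve hc hp hq, RNC.second_mem_curve hc hp hq⟩
    · rintro C ⟨hC, hpoints, hsec⟩
      exact RNC.eq_curve_of_isSecant hn hc hp hq hL hC (hpe ▸ hpoints 0) (hqe ▸ hpoints 1) hsec
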